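/- All functions are complex-valued and all spaces are taken with respect to Lebesgue measure. For a bounded operator $T$ on $L_2(\mathbb R)$ let $\mu(n,T)=\inf\{\|T-R\| : \operatorname{rank}(R)\le n\}$ for $n\ge 0$ (operator norm), and for $p>0$ let $\|T\|_p=\left(\sum_{n=0}^\infty \mu(n,T)^p\right)^{1/p}\in[0,\infty]$. For $\phi\in L_2(\mathbb R^2)$ let $\operatorname{Op}(\phi)$ be the integral operator on $L_2(\mathbb R)$ given by $(\operatorname{Op}(\phi)f)(y)=\int_{\mathbb R}\phi(x,y)f(x)\,dx$. For $k\in L_\infty(\mathbb R^2)$ define the Schur multiplier quasi-norm $$\|k\|_{\mathfrak M_p}=\sup\left\{\|\operatorname{Op}(k\phi)\|_p : \phi\in L_2(\mathbb R^2),\ \|\operatorname{Op}(\phi)\|_p\le 1\right\}\in[0,\infty].$$ **Theorem.** Let $k\in L_\infty(\mathbb R^2)$, let $0<p\le 1$, and put $p^\flat=\frac{2p}{2-p}$. Let $(t_j)_{j\in\mathbb Z}$ be real numbers such that the intervals $I_j=[t_j,t_{j+1})$, $j\in\mathbb Z$, form a partition of $\mathbb R$ (they are pairwise disjoint, with union $\mathbb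 R$; empty intervals are allowed). Set $k_j(t,s)=\chi_{I_j}(t)\,k(t,s)$ for $t,s\in\mathbb R$. Then $$\|k\|_{\mathfrak M_p}\le\left(\sum_{j\in\mathbb Z}\|k_j\|_{\mathfrak M_p}^{p^\flat}\right)^{1/p^\flat},$$ where the right-hand side may be $+\infty$. -/

import Mathlib

open MeasureTheory Set Function
open scoped ENNReal

/-- The complex Hilbert space `L_2(ℝ)` (Lebesgue measure). -/
abbrev L2R : Type := Lp ℂ 2 (volume : Measure ℝ)

/-- The complex space `L_2(ℝ²)` (Lebesgue measure). -/
abbrev L2R2 : Type := Lp ℂ 2 (volume : Measure (ℝ × ℝ))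

/-- The complex space `L_∞(ℝ²)` (Lebesgue measure). -/
abbrev LinftyR2 : Type := Lp ℂ ∞ (volume : Measure (ℝ × ℝ))

section IntegralOperator

lemma aestronglyMeasurable_kernel_mul (K : L2R2) (f : L2R) :
    AEStronglyMeasurable (fun z : ℝ × ℝ => K z * f z.1)
      ((volume : Measure ℝ).prod (volume : Measure ℝ)) :=
  (Lp.aestronglyMeasurable K).mul (Lp.aestronglyMeasurable f).comp_fst

lemma kernel_lintegral_le (K : L2R2) (f : L2R) :
    ∀ᵐ y : ℝ, ∫⁻ x, ‖K (x, y) * f x‖ₑ ≤ (∫⁻ x, ‖K (x, y)‖ₑ ^ (2 : ℝ)) ^ (1 / 2 : ℝ) * ‖f‖ₑ := by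
  have hK : AEStronglyMeasurable (fun z : ℝ × ℝ => K z.swap)
      ((volume : Measure ℝ).prod (volume : Measure ℝ)) :=
    (Lp.aestronglyMeasurable K).prod_swap
  filter_upwards [hK.prodMk_left] with y hy
  have h := ENNReal.lintegral_mul_le_Lp_mul_Lq (volume : Measure ℝ)
    (Real.HolderConjugate.two_two) hy.enorm (Lp.aestronglyMeasurable f).enorm
  simp only [enorm_mul]
  refine h.trans_eq ?_
  rw [Lp.enorm_def f, eLpNorm_eq_lintegral_rpow_enorm_toReal (by simp) (by simp)]
  simp

lemma kernel_sq_lintegral (K : L2R2) :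
    ∫⁻ y, ∫⁻ x, ‖K (x, y)‖ₑ ^ (2 : ℝ) = ‖K‖ₑ ^ (2 : ℝ) := by
  have hK : AEMeasurable (fun z : ℝ × ℝ => ‖K z‖ₑ ^ (2 : ℝ))
      ((volume : Measure ℝ).prod (volume : Measure ℝ)) :=
    (Lp.aestronglyMeasurable K).enorm.pow_const _
  rw [← lintegral_prod_symm _ hK, Lp.enorm_def K,
    eLpNorm_eq_lintegral_rpow_enorm_toReal (by simp) (by simp), ← ENNReal.rpow_mul]
  simp [Measure.volume_eq_prod]

lemma kernel_ae_integrable (K : L2R2) (f : L2R) :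
    ∀ᵐ y : ℝ, Integrable (fun x : ℝ => K (x, y) * f x) := by
  have hm : AEStronglyMeasurable (fun z : ℝ × ℝ => K z.swap * f z.2)
      ((volume : Measure ℝ).prod (volume : Measure ℝ)) :=
    (aestronglyMeasurable_kernel_mul K f).prod_swap
  have hK : AEMeasurable (fun z : ℝ × ℝ => ‖K z.swap‖ₑ ^ (2 : ℝ))
      ((volume : Measure ℝ).prod (volume : Measure ℝ)) :=
    (Lp.aestronglyMeasurable K).prod_swap.enorm.pow_const _
  have hfin := ae_lt_top' hK.lintegral_prod_right'
    (by
      have := kernel_sq_lintegral K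
      simp only [Prod.swap]
      rw [this]
      exact ENNReal.rpow_ne_top_of_nonneg (by norm_num) enorm_ne_top)
  filter_upwards [hm.prodMk_left, kernel_lintegral_le K f, hfin] with y h1 h2 h3
  refine ⟨h1, lt_of_le_of_lt h2 ?_⟩
  exact ENNReal.mul_lt_top (ENNReal.rpow_lt_top_of_nonneg (by norm_num) h3.ne) enorm_lt_top

lemma kernel_eLpNorm_le (K : L2R2) (f : L2R) :
    eLpNorm (fun y : ℝ => ∫ x, K (x, y) * f x) 2 volume ≤ ‖K‖ₑ * ‖f‖ₑ := by
  rw [eLpNorm_eq_lintegral_rpow_enorm_toReal (by simp) (by simp)]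
  have h : ∫⁻ y, ‖∫ x, K (x, y) * f x‖ₑ ^ (2 : ℝ) ≤ (‖K‖ₑ * ‖f‖ₑ) ^ (2 : ℝ) := by
    calc ∫⁻ y, ‖∫ x, K (x, y) * f x‖ₑ ^ (2 : ℝ)
        ≤ ∫⁻ y, (∫⁻ x, ‖K (x, y)‖ₑ ^ (2 : ℝ)) * ‖f‖ₑ ^ (2 : ℝ) := by
          refine lintegral_mono_ae ?_
          filter_upwards [kernel_lintegral_le K f] with y hy
          have h1 := (enorm_integral_le_lintegral_enorm (fun x => K (x, y) * f x)).trans hy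
          refine (ENNReal.rpow_le_rpow h1 (by norm_num : (0 : ℝ) ≤ 2)).trans_eq ?_
          rw [ENNReal.mul_rpow_of_nonneg _ _ (by norm_num), ← ENNReal.rpow_mul]
          norm_num
      _ = (‖K‖ₑ * ‖f‖ₑ) ^ (2 : ℝ) := by
          rw [lintegral_mul_const' _ _
            (ENNReal.rpow_ne_top_of_nonneg (by norm_num) enorm_ne_top),
            kernel_sq_lintegral, ENNReal.mul_rpow_of_nonneg _ _ (by norm_num)]
  rw [ENNReal.toReal_ofNat]
  refine (ENNReal.rpow_le_rpow (z := 1 / (2 : ℝ)) h (by norm_num)).trans_eq ?_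
  rw [← ENNReal.rpow_mul]
  norm_num

lemma kernel_memLp (K : L2R2) (f : L2R) :
    MemLp (fun y : ℝ => ∫ x, K (x, y) * f x) 2 volume := by
  refine ⟨(aestronglyMeasurable_kernel_mul K f).prod_swap.integral_prod_right', ?_⟩
  exact (kernel_eLpNorm_le K f).trans_lt (ENNReal.mul_lt_top enorm_lt_top enorm_lt_top)

/-- The integral operator with kernel `K ∈ L_2(ℝ²)`:
`Op(K) f (y) = ∫ K(x, y) f(x) dx` for `f ∈ L_2(ℝ)`, as a bounded operator on `L_2(ℝ)`. -/
noncomputable def Op (K : L2R2) : L2R →L[ℂ] L2R :=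
  LinearMap.mkContinuous
    { toFun := fun f => (kernel_memLp K f).toLp (fun y : ℝ => ∫ x, K (x, y) * f x)
      map_add' := fun f g => by
        rw [← MemLp.toLp_add]
        refine MemLp.toLp_congr _ _ ?_
        filter_upwards [kernel_ae_integrable K f, kernel_ae_integrable K g] with y hf hg
        rw [Pi.add_apply, ← integral_add hf hg]
        refine integral_congr_ae ?_
        filter_upwards [Lp.coeFn_add f g] with x hx
        rw [hx, Pi.add_apply, mul_add]
      map_smul' := fun c f => by
        rw [RingHom.id_apply, ← MemLp.toLp_const_smul]
        refine MemLp.toLp_congr _ _ ?_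
        refine Filter.Eventually.of_forall fun y => ?_
        simp only [Pi.smul_apply, smul_eq_mul]
        rw [← integral_const_mul]
        refine integral_congr_ae ?_
        filter_upwards [Lp.coeFn_smul c f] with x hx
        rw [hx, Pi.smul_apply, smul_eq_mul]
        ring }
    ‖K‖ (fun f => by
      have h := ENNReal.toReal_mono
        (ENNReal.mul_ne_top enorm_ne_top enorm_ne_top) (kernel_eLpNorm_le K f)
      simpa [Lp.norm_toLp] using h)

lemma Op_apply_ae (K : L2R2) (f : L2R) :
    ∀ᵐ y : ℝ, Op K f y = ∫ x, K (x, y) * f x :=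
  (kernel_memLp K f).coeFn_toLp

end IntegralOperator

/-- The `n`-th singular value
`μ(n, T) = inf {‖T - R‖ : R bounded, rank R ≤ n}` (operator norm). -/
noncomputable def singularNumber {H : Type*} [NormedAddCommGroup H] [InnerProductSpace ℂ H]
    (n : ℕ) (T : H →L[ℂ] H) : ℝ≥0∞ :=
  ⨅ (R : H →L[ℂ] H) (_ : LinearMap.rank (R : H →ₗ[ℂ] H) ≤ (n : Cardinal)), ‖T - R‖ₑ

/-- The Schatten--von Neumann quasi-norm
`‖T‖_p = (∑_{n ≥ 0} μ(n, T) ^ p) ^ (1 / p)`, with value `∞` exactly when `T ∉ 𝓛_p`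
(for `p > 0`; in particular when `T` is not compact). -/
noncomputable def schattenNorm {H : Type*} [NormedAddCommGroup H] [InnerProductSpace ℂ H]
    (p : ℝ) (T : H →L[ℂ] H) : ℝ≥0∞ :=
  (∑' n : ℕ, singularNumber n T ^ p) ^ (1 / p)

/-- The pointwise product `k φ ∈ L_2(ℝ²)` of `k ∈ L_∞(ℝ²)` and `φ ∈ L_2(ℝ²)`. -/
noncomputable def mulSymbol (k : LinftyR2) (φ : L2R2) : L2R2 :=
  ((Lp.memLp φ).mul' (Lp.memLp k)).toLp (fun z : ℝ × ℝ => k z * φ z)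

/-- The Schur multiplier quasi-norm
`‖k‖_{𝔐_p} = sup {‖Op(k φ)‖_p : φ ∈ L_2(ℝ²), ‖Op(φ)‖_p ≤ 1}`, with value `∞` when
`k` is not an `𝓛_p`-Schur multiplier. -/
noncomputable def schurNorm (p : ℝ) (k : LinftyR2) : ℝ≥0∞ :=
  ⨆ (φ : L2R2) (_ : schattenNorm p (Op φ) ≤ 1), schattenNorm p (Op (mulSymbol k φ))

/-- The function `(t, s) ↦ χ_I(t) k(t, s)`, for a measurable set `I ⊆ ℝ`,
as an element of `L_∞(ℝ²)`. -/
noncomputable def restrictFst (I : Set ℝ) (hI : MeasurableSet I) (k : LinftyR2) : LinftyR2 :=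
  ((Lp.memLp k).indicator (measurable_fst hI)).toLp
    ((Prod.fst ⁻¹' I).indicator (k : ℝ × ℝ → ℂ))

/-- The index `p^♭ = 2p / (2 - p)`. -/
noncomputable def pFlat (p : ℝ) : ℝ := 2 * p / (2 - p)

/-- The `ℓ_q(ℤ)` quasi-norm, `0 < q < ∞`, of a sequence of elements of `[0, ∞]`. -/
noncomputable def ellNorm (q : ℝ) (a : ℤ → ℝ≥0∞) : ℝ≥0∞ :=
  (∑' j : ℤ, a j ^ q) ^ (1 / q)

/-! For `0 < p ≤ 1` the `p`-th power of the Schatten quasi-norm is subadditive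
(`schattenSum_add_le`), so a multiplier need only be tested on rank one kernels `conj (u x) * v y`.
If these satisfy the bound with constant `C`, a Schmidt expansion with coefficients `s i` costs at
most `C * ∑ s i ^ p`, which is `C` times the `p`-th power for `Op φ`. General kernels follow by
truncation and lower semicontinuity (`schattenSum_schurCLM_le`). On a rank one kernel, split `u`
into its pieces `u_j` on the intervals. On the kernel of `u_j` and `v` the multipliers `k` and `k_j`
agree, so the `p`-th power is at most `∑ M_j ^ p * ‖u_j‖ ^ p * ‖v‖ ^ p`, with `M_j` the quasi-norm
of `k_j`. Hölder with exponents `p^♭ / p` and `2 / p`, together with `∑ ‖u_j‖ ^ 2 = ‖u‖ ^ 2`, yields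
the `ℓ_{p^♭}` norm (`schattenSum_rankOneKernel_le_ellNorm`). Subadditivity is a Rotfel'd-type
inequality: `|T|` is dominated, as a quadratic form, by a positive sum of rank one operators `c i ⟨z
i, ·⟩ z i` (`schattenSum_le_sum_rpow`). The trace of the `p`-th power of that sum is at most `∑ c i
^ p` (`sum_rpow_eigenvalues_le`). -/

/-! ### Singular numbers: elementary inequalities and a min-max lower bound. -/

section SingularNumbers

variable {H : Type*} [NormedAddCommGroup H] [InnerProductSpace ℂ H]

lemma singularNumber_le_enorm_sub {n : ℕ} (T R : H →L[ℂ] H)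
    (hR : LinearMap.rank (R : H →ₗ[ℂ] H) ≤ (n : Cardinal)) :
    singularNumber n T ≤ ‖T - R‖ₑ :=
  iInf₂_le R hR

lemma singularNumber_zero (n : ℕ) : singularNumber n (0 : H →L[ℂ] H) = 0 := by
  refine le_antisymm ((singularNumber_le_enorm_sub 0 0 ?_).trans ?_) zero_le
  · simp [LinearMap.rank]
  · simp [enorm]

lemma singularNumber_le_add_enorm (n : ℕ) (S T : H →L[ℂ] H) :
    singularNumber n S ≤ singularNumber n T + ‖S - T‖ₑ := by
  unfold singularNumber
  rw [ENNReal.iInf_add]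
  refine le_iInf fun R => ?_
  rw [ENNReal.iInf_add]
  refine le_iInf fun hR => (iInf₂_le R hR).trans ?_
  rw [add_comm, show S - R = (S - T) + (T - R) by abel]
  exact enorm_add_le (S - T) (T - R)

lemma enorm_comp_le (S T : H →L[ℂ] H) : ‖S ∘L T‖ₑ ≤ ‖S‖ₑ * ‖T‖ₑ := by
  simp only [enorm_eq_nnnorm]
  exact_mod_cast ContinuousLinearMap.opNNNorm_comp_le S T

lemma singularNumber_comp_right_le (n : ℕ) (T B : H →L[ℂ] H) (hB : ‖B‖ ≤ 1) :
    singularNumber n (T ∘L B) ≤ singularNumber n T := by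
  refine le_iInf₂ fun R hR => ?_
  refine (singularNumber_le_enorm_sub (T ∘L B) (R ∘L B) ?_).trans ?_
  · exact (LinearMap.rank_comp_le_left (B : H →ₗ[ℂ] H) (R : H →ₗ[ℂ] H)).trans hR
  · rw [← ContinuousLinearMap.sub_comp]
    refine (enorm_comp_le _ _).trans (mul_le_of_le_one_right' ?_)
    rw [← ofReal_norm]
    exact ENNReal.ofReal_le_one.2 hB

lemma singularNumber_comp_left_le (n : ℕ) (B T : H →L[ℂ] H) (hB : ‖B‖ ≤ 1) :
    singularNumber n (B ∘L T) ≤ singularNumber n T := by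
  refine le_iInf₂ fun R hR => ?_
  refine (singularNumber_le_enorm_sub (B ∘L T) (B ∘L R) ?_).trans ?_
  · have := LinearMap.lift_rank_comp_le_right (R : H →ₗ[ℂ] H) (B : H →ₗ[ℂ] H)
    simp only [Cardinal.lift_id] at this
    exact this.trans hR
  · rw [← ContinuousLinearMap.comp_sub]
    refine (enorm_comp_le _ _).trans (mul_le_of_le_one_left' ?_)
    rw [← ofReal_norm]
    exact ENNReal.ofReal_le_one.2 hB

lemma singularNumber_smul_le (n : ℕ) (c : ℂ) (T : H →L[ℂ] H) :
    singularNumber n (c • T) ≤ ‖c‖ₑ * singularNumber n T := by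
  -- For `c = 0` the scalar cannot be moved through the inner infimum, which is `∞` when the rank
  -- condition fails.
  rcases eq_or_ne c 0 with rfl | hc
  · rw [zero_smul, singularNumber_zero]
    exact zero_le
  unfold singularNumber
  rw [ENNReal.mul_iInf_of_ne (by simpa using hc) (by simp)]
  refine le_iInf fun R => ?_
  rw [ENNReal.mul_iInf_of_ne (by simpa using hc) (by simp)]
  refine le_iInf fun hR => ?_
  refine (iInf₂_le (c • R) ?_).trans ?_
  · have := LinearMap.lift_rank_comp_le_right (R : H →ₗ[ℂ] H) (c • LinearMap.id)
    simp only [Cardinal.lift_id] at this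
    refine le_trans (le_of_eq ?_) (this.trans hR)
    congr 1
  · rw [← smul_sub, enorm_smul]

/-- A lower bound for singular numbers from a subspace on which the operator is bounded below. -/
lemma le_singularNumber {n : ℕ} (T : H →L[ℂ] H) (V : Submodule ℂ H)
    (hV : n < Module.finrank ℂ V) (c : ℝ) (h : ∀ v ∈ V, c * ‖v‖ ≤ ‖T v‖) :
    ENNReal.ofReal c ≤ singularNumber n T := by
  refine le_iInf₂ fun R hR => ?_
  have : FiniteDimensional ℂ V := Module.finite_of_finrank_pos (by omega)
  let f : V →ₗ[ℂ] H := (R : H →ₗ[ℂ] H) ∘ₗ V.subtype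
  have hf : LinearMap.rank f ≤ (n : Cardinal) :=
    (LinearMap.rank_comp_le_left V.subtype (R : H →ₗ[ℂ] H)).trans hR
  have hfr : Module.finrank ℂ (LinearMap.range f) ≤ n := by
    rw [LinearMap.rank, ← Module.finrank_eq_rank] at hf
    exact_mod_cast hf
  -- Since `dim V > n`, some nonzero `v ∈ V` is killed by `R`, and there `T v = (T - R) v`.
  have hk : 0 < Module.finrank ℂ (LinearMap.ker f) := by
    have := f.finrank_range_add_finrank_ker
    omega
  obtain ⟨v, hv⟩ := Module.finrank_pos_iff_exists_ne_zero.1 hk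
  have hv0 : (R : H →L[ℂ] H) (v : V) = 0 := LinearMap.mem_ker.1 v.2
  have hne : 0 < ‖((v : V) : H)‖ := by
    rw [norm_pos_iff]
    simpa using hv
  rw [← ofReal_norm]
  refine ENNReal.ofReal_le_ofReal (le_of_mul_le_mul_right ?_ hne)
  refine (h _ (v : V).2).trans ?_
  have := (T - R).le_opNorm (v : V)
  simpa [hv0] using this

end SingularNumbers

/-! ### The `p`-th power of the Schatten quasi-norm and its lower semicontinuity. -/

section SchattenSum

variable {H : Type*} [NormedAddCommGroup H] [InnerProductSpace ℂ H]

/-- The `p`-th power `∑ μ(n, T) ^ p` of the Schatten quasi-norm. -/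
noncomputable def schattenSum (p : ℝ) (T : H →L[ℂ] H) : ℝ≥0∞ :=
  ∑' n : ℕ, singularNumber n T ^ p

lemma schattenNorm_eq (p : ℝ) (T : H →L[ℂ] H) : schattenNorm p T = schattenSum p T ^ (1 / p) := rfl

lemma schattenNorm_rpow {p : ℝ} (hp : 0 < p) (T : H →L[ℂ] H) :
    schattenNorm p T ^ p = schattenSum p T := by
  rw [schattenNorm_eq, ← ENNReal.rpow_mul, one_div_mul_cancel hp.ne', ENNReal.rpow_one]

lemma schattenSum_zero {p : ℝ} (hp : 0 < p) : schattenSum p (0 : H →L[ℂ] H) = 0 := by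
  simp [schattenSum, singularNumber_zero, hp]

lemma schattenSum_mono {p : ℝ} (hp : 0 < p) {S T : H →L[ℂ] H}
    (h : ∀ n, singularNumber n S ≤ singularNumber n T) : schattenSum p S ≤ schattenSum p T :=
  ENNReal.tsum_le_tsum fun n => ENNReal.rpow_le_rpow (h n) hp.le

lemma schattenSum_smul_le {p : ℝ} (hp : 0 < p) (c : ℂ) (T : H →L[ℂ] H) :
    schattenSum p (c • T) ≤ ‖c‖ₑ ^ p * schattenSum p T := by
  rw [schattenSum, schattenSum, ← ENNReal.tsum_mul_left]
  refine ENNReal.tsum_le_tsum fun n => ?_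
  rw [← ENNReal.mul_rpow_of_nonneg _ _ hp.le]
  exact ENNReal.rpow_le_rpow (singularNumber_smul_le n c T) hp.le

/-- Lower semicontinuity of `schattenSum` with respect to the operator norm. -/
lemma schattenSum_le_of_approx {p : ℝ} (hp : 0 < p) (T : H →L[ℂ] H) (C : ℝ≥0∞)
    (h : ∀ ε > 0, ∃ S : H →L[ℂ] H, ‖T - S‖ ≤ ε ∧ schattenSum p S ≤ C) :
    schattenSum p T ≤ C := by
  choose! S hS hC using h
  have hpos : ∀ k : ℕ, (0 : ℝ) < 1 / ((k : ℝ) + 1) := fun k => Nat.one_div_pos_of_nat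
  have hlim : Filter.Tendsto (fun k : ℕ => ENNReal.ofReal (1 / ((k : ℝ) + 1))) Filter.atTop
      (nhds 0) := by
    simpa using ENNReal.tendsto_ofReal (tendsto_one_div_add_atTop_nhds_zero_nat (𝕜 := ℝ))
  refine ENNReal.tsum_le_of_sum_range_le fun N => ?_
  -- Singular numbers are 1-Lipschitz in the operator norm; truncated subtraction expresses this,
  -- and `k → ∞` is taken with `N` fixed.
  have hb : ∀ k : ℕ, ∑ n ∈ Finset.range N,
      (singularNumber n T - ENNReal.ofReal (1 / ((k : ℝ) + 1))) ^ p ≤ C := by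
    intro k
    refine le_trans ?_ ((ENNReal.sum_le_tsum (Finset.range N)).trans (hC _ (hpos k)))
    refine Finset.sum_le_sum fun n _ => ENNReal.rpow_le_rpow ?_ hp.le
    rw [tsub_le_iff_right]
    refine (singularNumber_le_add_enorm n T (S (1 / ((k : ℝ) + 1)))).trans ?_
    gcongr
    rw [← ofReal_norm]
    exact ENNReal.ofReal_le_ofReal (hS _ (hpos k))
  have ht : Filter.Tendsto (fun k : ℕ => ∑ n ∈ Finset.range N,
      (singularNumber n T - ENNReal.ofReal (1 / ((k : ℝ) + 1))) ^ p) Filter.atTop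
      (nhds (∑ n ∈ Finset.range N, singularNumber n T ^ p)) := by
    refine tendsto_finsetSum _ fun n _ => ?_
    refine (ENNReal.continuous_rpow_const.tendsto _).comp ?_
    have := ENNReal.Tendsto.sub (tendsto_const_nhds (x := singularNumber n T)) hlim
      (Or.inr ENNReal.zero_ne_top)
    simpa using this
  exact le_of_tendsto' ht hb

end SchattenSum

/-! ### Singular value decomposition of finite-rank operators. -/

section SingularValueDecomposition

variable {H : Type*} [NormedAddCommGroup H] [InnerProductSpace ℂ H]

/-- `T = ∑ i, s i ⟨u i, ·⟩ v i` with `s` positive and decreasing and `u`, `v` orthonormal. -/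
structure IsSVD {m : ℕ} (T : H →L[ℂ] H) (s : Fin m → ℝ) (u v : Fin m → H) : Prop where
  pos : ∀ i, 0 < s i
  antitone : Antitone s
  left : Orthonormal ℂ u
  right : Orthonormal ℂ v
  apply_eq : ∀ x, T x = ∑ i, ((s i : ℂ) * inner ℂ (u i) x) • v i

/-- The range is invariant and its orthogonal complement is the kernel, so it suffices to
diagonalise on the finite-dimensional range, where no eigenvalue can vanish. -/
lemma exists_eigendecomposition [CompleteSpace H] (P : H →L[ℂ] H) (hP : P.IsPositive)
    [FiniteDimensional ℂ (LinearMap.range (P : H →ₗ[ℂ] H))] :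
    ∃ (m : ℕ) (l : Fin m → ℝ) (w : Fin m → H), IsSVD P l w w := by
  set V : Submodule ℂ H := LinearMap.range (P : H →ₗ[ℂ] H) with hV
  have hsymm : (P : H →ₗ[ℂ] H).IsSymmetric := hP.isSymmetric
  have hinv : ∀ v ∈ V, (P : H →ₗ[ℂ] H) v ∈ V := fun v _ => LinearMap.mem_range_self _ v
  have horth : Vᗮ = LinearMap.ker (P : H →ₗ[ℂ] H) := hsymm.orthogonal_range
  have hker : ∀ x, P (x - V.starProjection x) = 0 := fun x =>
    LinearMap.mem_ker.1 (horth ▸ V.sub_starProjection_mem_orthogonal x)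
  have hPS := hsymm.restrict_invariant hinv
  let b := hPS.eigenvectorBasis rfl
  let l := hPS.eigenvalues rfl
  have hb : ∀ i, P (b i : H) = (l i : ℂ) • (b i : H) := fun i =>
    congrArg Subtype.val (hPS.apply_eigenvectorBasis rfl i)
  have hon : Orthonormal ℂ (fun i => (b i : H)) :=
    b.orthonormal.comp_linearIsometry V.subtypeₗᵢ
  have hin : ∀ i, inner ℂ (P (b i : H)) (b i : H) = (l i : ℂ) := by
    intro i
    rw [hb, inner_smul_left, inner_self_eq_norm_sq_to_K, hon.1 i]
    simp
  have hnn : ∀ i, 0 ≤ l i := by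
    intro i
    have := hP.re_inner_nonneg_left (b i : H)
    rw [hin] at this
    simpa using this
  have hne : ∀ i, l i ≠ 0 := by
    intro i hi
    have h0 : P (b i : H) = 0 := by rw [hb, hi]; simp
    have h1 : (b i : H) ∈ Vᗮ := by
      rw [horth]; exact h0
    have h2 : inner ℂ (b i : H) (b i : H) = 0 := Submodule.inner_right_of_mem_orthogonal (b i).2 h1
    have h3 := hon.1 i
    rw [inner_self_eq_zero] at h2
    simp [h2] at h3
  refine ⟨_, l, fun i => (b i : H), fun i => lt_of_le_of_ne (hnn i) (hne i).symm,
    hPS.eigenvalues_antitone rfl, hon, hon, fun x => ?_⟩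
  have h1 : P x = P (V.starProjection x) := by
    have := hker x
    rwa [map_sub, sub_eq_zero] at this
  have h2 : V.starProjection x = ∑ i, inner ℂ (b i : H) x • (b i : H) := by
    have := congrArg (Subtype.val) (b.sum_repr' (V.orthogonalProjectionOnto x))
    simp only [Submodule.coe_sum, Submodule.coe_smul] at this
    rw [Submodule.starProjection_apply, ← this]
    refine Finset.sum_congr rfl fun i _ => ?_
    congr 1
    exact V.inner_orthogonalProjectionOnto_eq_of_mem_left (b i) x
  rw [h1, h2, map_sum]
  refine Finset.sum_congr rfl fun i _ => ?_
  rw [map_smul, hb, smul_smul, mul_comm]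

/-- Diagonalise `T* T`, take square roots of the eigenvalues `l i`, and set `v i = T (w i) / √(l
i)`. Off the span of the `w i`, `T` vanishes because `‖T z‖ ^ 2 = ⟨z, T* T z⟩`. -/
lemma exists_isSVD [CompleteSpace H] (T : H →L[ℂ] H)
    [FiniteDimensional ℂ (LinearMap.range (T : H →ₗ[ℂ] H))] :
    ∃ (m : ℕ) (s : Fin m → ℝ) (u v : Fin m → H), IsSVD T s u v := by
  let P : H →L[ℂ] H := T.adjoint ∘L T
  have hPpos : P.IsPositive := ContinuousLinearMap.isPositive_adjoint_comp_self T
  have hfd : FiniteDimensional ℂ (LinearMap.range (P : H →ₗ[ℂ] H)) := by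
    have : LinearMap.range (P : H →ₗ[ℂ] H) =
        (LinearMap.range (T : H →ₗ[ℂ] H)).map (T.adjoint : H →ₗ[ℂ] H) :=
      LinearMap.range_comp (T : H →ₗ[ℂ] H) (T.adjoint : H →ₗ[ℂ] H)
    rw [this]
    infer_instance
  obtain ⟨m, l, w, hl, hanti, hw, -, hPw⟩ := exists_eigendecomposition P hPpos
  have hPwi : ∀ i, P (w i) = (l i : ℂ) • w i := by
    intro i
    rw [hPw, Finset.sum_eq_single i]
    · rw [inner_self_eq_norm_sq_to_K, hw.1 i]; simp
    · intro j _ hj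
      rw [hw.2 hj]; simp
    · simp
  have hTin : ∀ x y, inner ℂ (T x) (T y) = inner ℂ x (P y) := by
    intro x y
    exact (ContinuousLinearMap.adjoint_inner_right T x (T y)).symm
  have hs : ∀ i, 0 < √(l i) := fun i => Real.sqrt_pos.2 (hl i)
  have hsc : ∀ i, ((√(l i) : ℝ) : ℂ) ≠ 0 := fun i => by exact_mod_cast (hs i).ne'
  have hsq : ∀ i, ((√(l i) : ℝ) : ℂ) * ((√(l i) : ℝ) : ℂ) = (l i : ℂ) := fun i => by
    exact_mod_cast Real.mul_self_sqrt (hl i).le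
  refine ⟨m, fun i => √(l i), w, fun i => ((√(l i) : ℝ) : ℂ)⁻¹ • T (w i), hs,
    fun i j hij => Real.sqrt_le_sqrt (hanti hij), hw, ?_, ?_⟩
  · rw [orthonormal_iff_ite]
    intro i j
    rw [inner_smul_left, inner_smul_right, hTin, hPwi, inner_smul_right,
      (orthonormal_iff_ite.1 hw) i j]
    split_ifs with h
    · subst h
      rw [← hsq]
      simp only [map_inv₀, Complex.conj_ofReal]
      field_simp [hsc i]
    · simp
  · intro x
    have hz : T (x - ∑ i, inner ℂ (w i) x • w i) = 0 := by
      have hP0 : P (x - ∑ i, inner ℂ (w i) x • w i) = 0 := by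
        rw [map_sub, map_sum, hPw x, sub_eq_zero]
        refine Finset.sum_congr rfl fun i _ => ?_
        rw [map_smul, hPwi, smul_smul, mul_comm]
      have := hTin (x - ∑ i, inner ℂ (w i) x • w i) (x - ∑ i, inner ℂ (w i) x • w i)
      rw [hP0, inner_zero_right, inner_self_eq_zero] at this
      exact this
    rw [map_sub, sub_eq_zero] at hz
    rw [hz, map_sum]
    refine Finset.sum_congr rfl fun i _ => ?_
    rw [map_smul, smul_smul]
    congr 1
    field_simp [hsc i]

lemma inner_sum_smul_orthonormal {m : ℕ} {u : Fin m → H} (hu : Orthonormal ℂ u)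
    (c : Fin m → ℂ) (i : Fin m) : inner ℂ (u i) (∑ j, c j • u j) = c i :=
  hu.inner_right_fintype c i

lemma norm_sq_sum_smul_orthonormal {m : ℕ} {u : Fin m → H} (hu : Orthonormal ℂ u)
    (c : Fin m → ℂ) : ‖∑ j, c j • u j‖ ^ 2 = ∑ j, ‖c j‖ ^ 2 := by
  have h : inner ℂ (∑ j, c j • u j) (∑ j, c j • u j) = ∑ j, (starRingEnd ℂ) (c j) * c j :=
    hu.inner_sum c c Finset.univ
  rw [← inner_self_eq_norm_sq (𝕜 := ℂ), h]
  simp [Complex.conj_mul', ← Complex.ofReal_pow]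

lemma sum_norm_inner_sq_le {m : ℕ} {u : Fin m → H} (hu : Orthonormal ℂ u) (x : H) :
    ∑ i, ‖inner ℂ (u i) x‖ ^ 2 ≤ ‖x‖ ^ 2 :=
  hu.sum_inner_products_le x

namespace IsSVD

variable {m : ℕ} {T : H →L[ℂ] H} {s : Fin m → ℝ} {u v : Fin m → H}

/-- The span of the first `i + 1` vectors of an orthonormal family has dimension at least `i + 1`. -/
lemma finrank_span_Iic (hu : Orthonormal ℂ u) (i : Fin m) :
    (i : ℕ) < Module.finrank ℂ (Submodule.span ℂ (Set.range fun j : Set.Iic i => u j)) := by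
  have hli : LinearIndependent ℂ (fun j : Set.Iic i => u j) :=
    hu.linearIndependent.comp _ Subtype.val_injective
  rw [finrank_span_eq_card hli]
  simp

lemma exists_coeff_of_mem_span_Iic (i : Fin m) {x : H}
    (hx : x ∈ Submodule.span ℂ (Set.range fun j : Set.Iic i => u j)) :
    ∃ c : Fin m → ℂ, (∀ j, i < j → c j = 0) ∧ x = ∑ j, c j • u j := by
  induction hx using Submodule.span_induction with
  | mem x hx =>
    obtain ⟨⟨j, hj⟩, rfl⟩ := hx
    refine ⟨Pi.single j 1, fun k hk => ?_, ?_⟩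
    · exact Pi.single_eq_of_ne (lt_of_le_of_lt hj hk).ne' _
    · simp [Pi.single_apply]
  | zero => exact ⟨0, by simp, by simp⟩
  | add x y _ _ hx hy =>
    obtain ⟨c, hc, rfl⟩ := hx
    obtain ⟨d, hd, rfl⟩ := hy
    exact ⟨c + d, fun j hj => by simp [hc j hj, hd j hj], by
      simp [add_smul, Finset.sum_add_distrib]⟩
  | smul a x _ hx =>
    obtain ⟨c, hc, rfl⟩ := hx
    exact ⟨a • c, fun j hj => by simp [hc j hj], by simp [Finset.smul_sum, smul_smul]⟩

/-- On the span of the first `i + 1` vectors the form of `P` is at least `s i * ‖x‖ ^ 2`, so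
Cauchy–Schwarz bounds `P` below there. This converts domination of quadratic forms into domination
of singular numbers. -/
lemma le_singularNumber_of_inner (hs : Antitone s) (hu : Orthonormal ℂ u)
    (P : H →L[ℂ] H)
    (hP : ∀ x, ∑ i, s i * ‖inner ℂ (u i) x‖ ^ 2 ≤ RCLike.re (inner ℂ (P x) x)) (i : Fin m) :
    ENNReal.ofReal (s i) ≤ singularNumber i P := by
  refine le_singularNumber P _ (finrank_span_Iic hu i) _ fun x hx => ?_
  obtain ⟨c, hc, rfl⟩ := exists_coeff_of_mem_span_Iic i hx
  set x := ∑ j, c j • u j with hxdef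
  rcases eq_or_ne x 0 with h0 | h0
  · simp [h0]
  have hpos : 0 < ‖x‖ := norm_pos_iff.2 h0
  refine le_of_mul_le_mul_right ?_ hpos
  calc s i * ‖x‖ * ‖x‖ = s i * ∑ j, ‖c j‖ ^ 2 := by
        rw [← norm_sq_sum_smul_orthonormal hu c]; ring
    _ ≤ ∑ j, s j * ‖inner ℂ (u j) x‖ ^ 2 := by
        rw [Finset.mul_sum]
        refine Finset.sum_le_sum fun j _ => ?_
        rw [hxdef, inner_sum_smul_orthonormal hu]
        rcases lt_or_ge i j with h | h
        · simp [hc j h]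
        · exact mul_le_mul_of_nonneg_right (hs h) (by positivity)
    _ ≤ RCLike.re (inner ℂ (P x) x) := hP x
    _ ≤ ‖P x‖ * ‖x‖ := re_inner_le_norm _ _

lemma le_singularNumber (h : IsSVD T s u v) (i : Fin m) :
    ENNReal.ofReal (s i) ≤ singularNumber i T := by
  refine _root_.le_singularNumber T _ (finrank_span_Iic h.left i) _ fun x hx => ?_
  obtain ⟨c, hc, rfl⟩ := exists_coeff_of_mem_span_Iic i hx
  refine le_of_sq_le_sq ?_ (norm_nonneg _)
  rw [h.apply_eq, mul_pow, norm_sq_sum_smul_orthonormal h.left,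
    norm_sq_sum_smul_orthonormal h.right, Finset.mul_sum]
  refine Finset.sum_le_sum fun j _ => ?_
  rw [inner_sum_smul_orthonormal h.left, norm_mul, mul_pow]
  rcases lt_or_ge i j with hij | hij
  · simp [hc j hij]
  · refine mul_le_mul_of_nonneg_right ?_ (by positivity)
    have := (h.pos i).le
    have h2 := h.antitone hij
    rw [Complex.norm_real, Real.norm_eq_abs, sq_abs]
    gcongr

lemma singularNumber_eq_zero (h : IsSVD T s u v) {n : ℕ} (hn : m ≤ n) :
    singularNumber n T = 0 := by
  refine le_antisymm ((singularNumber_le_enorm_sub T T ?_).trans ?_) zero_le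
  · have hsub : LinearMap.range (T : H →ₗ[ℂ] H) ≤ Submodule.span ℂ (Set.range v) := by
      rintro _ ⟨x, rfl⟩
      rw [ContinuousLinearMap.coe_coe, h.apply_eq]
      exact Submodule.sum_mem _ fun i _ =>
        Submodule.smul_mem _ _ (Submodule.subset_span ⟨i, rfl⟩)
    refine (Submodule.rank_mono hsub).trans ((rank_span_le _).trans ?_)
    have hcard := Cardinal.mk_range_le_lift (f := v)
    simp only [Cardinal.lift_id', Cardinal.mk_fin, Cardinal.lift_natCast] at hcard
    refine le_trans ?_ (Nat.cast_le.2 hn)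
    simpa using hcard
  · rw [sub_self]; simp [enorm]

lemma singularNumber_le (h : IsSVD T s u v) (i : Fin m) :
    singularNumber i T ≤ ENNReal.ofReal (s i) := by
  classical
  -- The strict inequality `j < i` leaves exactly `i` terms, as the zero-based index requires; the
  -- largest remaining coefficient is `s i`.
  let R : H →L[ℂ] H := ∑ j ∈ Finset.Iio i, (s j : ℂ) • InnerProductSpace.rankOne ℂ (v j) (u j)
  refine (singularNumber_le_enorm_sub T R ?_).trans ?_
  · have hsub : LinearMap.range (R : H →ₗ[ℂ] H) ≤
        Submodule.span ℂ ((Finset.Iio i).image v : Set H) := by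
      rintro _ ⟨x, rfl⟩
      simp only [R, ContinuousLinearMap.coe_coe, sum_apply,
        smul_apply, InnerProductSpace.rankOne_apply]
      refine Submodule.sum_mem _ fun j hj =>
        Submodule.smul_mem _ _ (Submodule.smul_mem _ _ (Submodule.subset_span ?_))
      exact Finset.mem_coe.2 (Finset.mem_image_of_mem v hj)
    refine (Submodule.rank_mono hsub).trans ((rank_span_finset_le _).trans ?_)
    have := (Finset.card_image_le (s := Finset.Iio i) (f := v))
    rw [Fin.card_Iio] at this
    exact_mod_cast this
  · rw [← ofReal_norm]
    refine ENNReal.ofReal_le_ofReal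
      (ContinuousLinearMap.opNorm_le_bound _ (h.pos i).le fun x => ?_)
    have hTR : (T - R) x = ∑ j, ((if j < i then 0 else s j : ℝ) * inner ℂ (u j) x) • v j := by
      rw [sub_apply, h.apply_eq]
      simp only [R, sum_apply,
        smul_apply, InnerProductSpace.rankOne_apply, smul_smul]
      rw [sub_eq_iff_eq_add, ← Finset.sum_filter_add_sum_filter_not Finset.univ (· < i),
        ← Finset.sum_filter_add_sum_filter_not (Finset.univ : Finset (Fin m)) (· < i)
          (fun j => ((if j < i then 0 else s j : ℝ) * inner ℂ (u j) x : ℂ) • v j)]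
      have e1 : Finset.univ.filter (· < i) = Finset.Iio i := by ext; simp
      rw [e1, Finset.sum_eq_zero (s := Finset.Iio i)
        (f := fun j => ((if j < i then 0 else s j : ℝ) * inner ℂ (u j) x : ℂ) • v j), zero_add,
        add_comm]
      · congr 1
        refine Finset.sum_congr rfl fun j hj => ?_
        simp only [Finset.mem_filter] at hj
        rw [if_neg hj.2]
      · intro j hj
        simp only [Finset.mem_Iio] at hj
        simp [hj]
    refine le_of_sq_le_sq ?_ (mul_nonneg (h.pos i).le (norm_nonneg _))
    rw [hTR, norm_sq_sum_smul_orthonormal h.right, mul_pow]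
    refine le_trans ?_ (mul_le_mul_of_nonneg_left (sum_norm_inner_sq_le h.left x) (by positivity))
    rw [Finset.mul_sum]
    refine Finset.sum_le_sum fun j _ => ?_
    rw [norm_mul, mul_pow]
    refine mul_le_mul_of_nonneg_right ?_ (by positivity)
    rw [Complex.norm_real, Real.norm_eq_abs, sq_abs]
    split_ifs with hij
    · simp; positivity
    · have := (h.pos j).le
      have h2 := h.antitone (not_lt.1 hij)
      gcongr

lemma schattenSum_eq (h : IsSVD T s u v) {p : ℝ} (hp : 0 < p) :
    schattenSum p T = ∑ i, ENNReal.ofReal (s i) ^ p := by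
  rw [schattenSum, tsum_eq_sum (s := Finset.range m), Finset.sum_range]
  · exact Finset.sum_congr rfl fun i _ => by
      rw [le_antisymm (h.singularNumber_le i) (h.le_singularNumber i)]
  · intro n hn
    rw [h.singularNumber_eq_zero (by simpa using hn), ENNReal.zero_rpow_of_pos hp]

end IsSVD

end SingularValueDecomposition

/-! ### The `p`-triangle inequality for Schatten quasi-norms. -/

section Triangle

variable {H : Type*} [NormedAddCommGroup H] [InnerProductSpace ℂ H]

lemma finiteDimensional_range_of_sum {ι : Type*} [Fintype ι] (T : H →L[ℂ] H) (c : ι → H → ℂ)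
    (y : ι → H) (hT : ∀ x, T x = ∑ i, c i x • y i) :
    FiniteDimensional ℂ (LinearMap.range (T : H →ₗ[ℂ] H)) := by
  have hsub : LinearMap.range (T : H →ₗ[ℂ] H) ≤ Submodule.span ℂ (Set.range y) := by
    rintro _ ⟨x, rfl⟩
    rw [ContinuousLinearMap.coe_coe, hT]
    exact Submodule.sum_mem _ fun i _ =>
      Submodule.smul_mem _ _ (Submodule.subset_span ⟨i, rfl⟩)
  have : FiniteDimensional ℂ (Submodule.span ℂ (Set.range y)) :=
    FiniteDimensional.span_of_finite ℂ (Set.finite_range y)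
  exact Submodule.finiteDimensional_of_le hsub

/-- Weighted AM–GM, `(c / l) ^ (1 - p) ≤ (1 - p) * (c / l) + p`, interpolates between the two
hypotheses, which are bounds for the exponents `0` and `-1` of `l`. -/
lemma sum_mul_rpow_le {m : ℕ} {p : ℝ} (hp0 : 0 < p) (hp1 : p ≤ 1) (a l : Fin m → ℝ)
    (ha : ∀ n, 0 ≤ a n) (hl : ∀ n, 0 < l n) (h1 : ∑ n, a n ≤ 1) {c : ℝ} (hc : 0 < c)
    (h2 : c * ∑ n, a n / l n ≤ 1) :
    ∑ n, a n * l n ^ (p - 1) ≤ c ^ (p - 1) := by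
  have hcp : 0 < c ^ (p - 1) := Real.rpow_pos_of_pos hc _
  have key : ∀ n, a n * l n ^ (p - 1) ≤ c ^ (p - 1) * ((1 - p) * (c * (a n / l n)) + p * a n) := by
    intro n
    have hb := Real.geom_mean_le_arith_mean2_weighted (w₁ := 1 - p) (w₂ := p) (p₁ := c / l n)
      (p₂ := 1) (by linarith) hp0.le (div_pos hc (hl n)).le zero_le_one (by ring)
    rw [Real.one_rpow, mul_one, mul_one, Real.div_rpow hc.le (hl n).le] at hb
    have e1 : l n ^ (p - 1) = c ^ (p - 1) * (c ^ (1 - p) / l n ^ (1 - p)) := by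
      rw [← mul_div_assoc, ← Real.rpow_add hc, show p - 1 + (1 - p) = 0 by ring, Real.rpow_zero,
        show p - 1 = -(1 - p) by ring, Real.rpow_neg (hl n).le, one_div]
    rw [e1, mul_left_comm]
    refine mul_le_mul_of_nonneg_left ?_ hcp.le
    refine (mul_le_mul_of_nonneg_left hb (ha n)).trans_eq ?_
    ring
  refine (Finset.sum_le_sum fun n _ => key n).trans ?_
  rw [← Finset.mul_sum, Finset.sum_add_distrib, ← Finset.mul_sum, ← Finset.mul_sum,
    ← Finset.mul_sum]
  refine mul_le_of_le_one_right hcp.le ?_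
  have h3 := mul_le_mul_of_nonneg_left h2 (show 0 ≤ 1 - p by linarith)
  have h4 := mul_le_mul_of_nonneg_left h1 hp0.le
  linarith

lemma re_mul_inner_le (a b : ℂ) : (a * (starRingEnd ℂ) b).re ≤ ‖(1 / 2 : ℂ) * (a + b)‖ ^ 2 := by
  rw [← Complex.normSq_eq_norm_sq, Complex.normSq_apply]
  simp
  nlinarith [sq_nonneg (a.re - b.re), sq_nonneg (a.im - b.im)]

/-- Rotfel'd-type inequality for sums of positive rank one operators. -/
lemma sum_rpow_eigenvalues_le {ι : Type*} [Fintype ι] {p : ℝ} (hp0 : 0 < p) (hp1 : p ≤ 1)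
    {m : ℕ} {P : H →L[ℂ] H} {l : Fin m → ℝ} {w : Fin m → H} (hP : IsSVD P l w w)
    (c : ι → ℝ) (z : ι → H) (hc : ∀ i, 0 < c i) (hz : ∀ i, ‖z i‖ ≤ 1)
    (hPz : ∀ x, P x = ∑ i, ((c i : ℂ) * inner ℂ (z i) x) • z i) :
    ∑ n, l n ^ p ≤ ∑ i, c i ^ p := by
  have hform : ∀ x, inner ℂ x (P x) = ((∑ i, c i * ‖inner ℂ (z i) x‖ ^ 2 : ℝ) : ℂ) := by
    intro x
    rw [hPz, inner_sum, Complex.ofReal_sum]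
    refine Finset.sum_congr rfl fun i _ => ?_
    rw [inner_smul_right, ← inner_conj_symm x (z i), mul_assoc, Complex.mul_conj']
    push_cast
    rfl
  have hform' : ∀ x, inner ℂ x (P x) = ((∑ n, l n * ‖inner ℂ (w n) x‖ ^ 2 : ℝ) : ℂ) := by
    intro x
    rw [hP.apply_eq, inner_sum, Complex.ofReal_sum]
    refine Finset.sum_congr rfl fun i _ => ?_
    rw [inner_smul_right, ← inner_conj_symm x (w i), mul_assoc, Complex.mul_conj']
    push_cast
    rfl
  have hln : ∀ n, l n = ∑ i, c i * ‖inner ℂ (w n) (z i)‖ ^ 2 := by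
    intro n
    have h1 := (hform (w n)).symm.trans (hform' (w n))
    rw [Complex.ofReal_inj] at h1
    simp only [norm_inner_symm (w n) (z _)]
    rw [h1, Finset.sum_eq_single n]
    · rw [inner_self_eq_norm_sq_to_K, hP.left.1 n]; simp
    · intro j _ hj
      rw [hP.left.2 hj]; simp
    · simp
  -- Formally `c i * ⟨z i, P⁻¹ z i⟩ ≤ 1`, because `P` dominates its `i`-th summand. The vector `y`
  -- below plays the role of `P⁻¹ z i`, with the inverse taken on the range.
  have hq : ∀ i, c i * ∑ n, ‖inner ℂ (w n) (z i)‖ ^ 2 / l n ≤ 1 := by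
    intro i
    set q := ∑ n, ‖inner ℂ (w n) (z i)‖ ^ 2 / l n with hqdef
    have hq0 : 0 ≤ q := Finset.sum_nonneg fun n _ => div_nonneg (by positivity) (hP.pos n).le
    let y : H := ∑ n, (inner ℂ (w n) (z i) / (l n : ℂ)) • w n
    have hy : ∀ n, inner ℂ (w n) y = inner ℂ (w n) (z i) / (l n : ℂ) := fun n =>
      inner_sum_smul_orthonormal hP.left _ n
    have h1 : ∑ n, l n * ‖inner ℂ (w n) y‖ ^ 2 = q := by
      refine Finset.sum_congr rfl fun n _ => ?_
      have := (hP.pos n)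
      rw [hy, norm_div, Complex.norm_real, Real.norm_eq_abs, abs_of_pos this]
      field_simp
    have h2 : inner ℂ (z i) y = (q : ℂ) := by
      rw [hqdef, Complex.ofReal_sum, inner_sum]
      refine Finset.sum_congr rfl fun n _ => ?_
      rw [inner_smul_right, ← inner_conj_symm (z i) (w n), div_mul_eq_mul_div, Complex.mul_conj']
      push_cast
      rfl
    have h3 := (hform y).symm.trans (hform' y)
    rw [Complex.ofReal_inj, h1] at h3
    -- The form of `P` at `y` equals `q`, and its `i`-th term alone is `c i * q ^ 2`.
    have h4 : c i * q ^ 2 ≤ q := by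
      rw [← h3]
      refine le_trans (le_of_eq ?_) (Finset.single_le_sum
        (f := fun j => c j * ‖inner ℂ (z j) y‖ ^ 2)
        (fun j _ => mul_nonneg (hc j).le (by positivity)) (Finset.mem_univ i))
      simp only [h2, Complex.norm_real, Real.norm_eq_abs, sq_abs, h3]
    rcases hq0.eq_or_lt with h5 | h5
    · rw [← h5]; simp
    · refine le_of_mul_le_mul_right ?_ h5
      rw [one_mul]
      refine le_trans (le_of_eq ?_) h4
      ring
  -- Write `l ^ p = l * l ^ (p - 1)` and expand only the first factor as `⟨w n, P w n⟩`.
  calc ∑ n, l n ^ p = ∑ n, ∑ i, c i * (‖inner ℂ (w n) (z i)‖ ^ 2 * l n ^ (p - 1)) := by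
        refine Finset.sum_congr rfl fun n _ => ?_
        conv_lhs => rw [show p = 1 + (p - 1) by ring, Real.rpow_add (hP.pos n), Real.rpow_one]
        conv_lhs => enter [1]; rw [hln n]
        rw [Finset.sum_mul]
        exact Finset.sum_congr rfl fun i _ => by ring
    _ = ∑ i, c i * ∑ n, ‖inner ℂ (w n) (z i)‖ ^ 2 * l n ^ (p - 1) := by
        rw [Finset.sum_comm]
        exact Finset.sum_congr rfl fun i _ => by rw [Finset.mul_sum]
    _ ≤ ∑ i, c i * c i ^ (p - 1) := by
        refine Finset.sum_le_sum fun i _ => mul_le_mul_of_nonneg_left ?_ (hc i).le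
        refine sum_mul_rpow_le hp0 hp1 _ l (fun n => by positivity) hP.pos ?_ (hc i) (hq i)
        refine (sum_norm_inner_sq_le hP.left (z i)).trans ?_
        exact pow_le_one₀ (norm_nonneg _) (hz i)
    _ = ∑ i, c i ^ p := by
        refine Finset.sum_congr rfl fun i _ => ?_
        conv_rhs => rw [show p = 1 + (p - 1) by ring, Real.rpow_add (hc i), Real.rpow_one]

/-- The Schatten quasi-norm, `0 < p ≤ 1`, of a finite sum of rank one operators. -/
lemma schattenSum_le_sum_rpow [CompleteSpace H] {ι : Type*} [Fintype ι] {p : ℝ} (hp0 : 0 < p)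
    (hp1 : p ≤ 1) (T : H →L[ℂ] H) (c : ι → ℝ) (x y : ι → H) (hc : ∀ i, 0 < c i)
    (hx : ∀ i, ‖x i‖ ≤ 1) (hy : ∀ i, ‖y i‖ ≤ 1)
    (hT : ∀ f, T f = ∑ i, ((c i : ℂ) * inner ℂ (x i) f) • y i) :
    schattenSum p T ≤ ∑ i, ENNReal.ofReal (c i) ^ p := by
  have := finiteDimensional_range_of_sum T _ y hT
  obtain ⟨m, s, u, v, hsvd⟩ := exists_isSVD T
  -- This is `U* y i` for the partial isometry `U : u n ↦ v n` of the polar decomposition `T = U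
  -- |T|`, so that `|T| = U* T` is the sum of `c i ⟨x i, ·⟩ y' i`.
  let y' : ι → H := fun i => ∑ n, inner ℂ (v n) (y i) • u n
  have hy' : ∀ i, ‖y' i‖ ≤ 1 := by
    intro i
    refine le_of_sq_le_sq ?_ zero_le_one
    rw [norm_sq_sum_smul_orthonormal hsvd.left, one_pow]
    exact (sum_norm_inner_sq_le hsvd.right _).trans (pow_le_one₀ (norm_nonneg _) (hy i))
  -- By polarisation, `re (a * conj b) ≤ ‖(a + b) / 2‖ ^ 2`; averaging `x i` and `y' i` therefore
  -- gives a positive form dominating that of `|T|`.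
  let z : ι → H := fun i => (1 / 2 : ℂ) • (x i + y' i)
  have hz : ∀ i, ‖z i‖ ≤ 1 := by
    intro i
    rw [norm_smul]
    have h1 := norm_add_le (x i) (y' i)
    have h2 := hx i
    have h3 := hy' i
    norm_num
    linarith
  let P : H →L[ℂ] H := ∑ i, (c i : ℂ) • InnerProductSpace.rankOne ℂ (z i) (z i)
  have hPz : ∀ f, P f = ∑ i, ((c i : ℂ) * inner ℂ (z i) f) • z i := by
    intro f
    simp only [P, sum_apply, smul_apply, InnerProductSpace.rankOne_apply, smul_smul]
  have hPform : ∀ f, inner ℂ (P f) f = ((∑ i, c i * ‖inner ℂ (z i) f‖ ^ 2 : ℝ) : ℂ) := by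
    intro f
    rw [hPz, sum_inner, Complex.ofReal_sum]
    refine Finset.sum_congr rfl fun i _ => ?_
    rw [inner_smul_left, map_mul, Complex.conj_ofReal, mul_assoc, Complex.conj_mul']
    push_cast
    rfl
  have hPpos : P.IsPositive := by
    rw [ContinuousLinearMap.isPositive_iff_complex]
    intro f
    rw [hPform]
    refine ⟨by rw [RCLike.re_eq_complex_re, Complex.ofReal_re], ?_⟩
    rw [RCLike.re_eq_complex_re, Complex.ofReal_re]
    exact Finset.sum_nonneg fun i _ => mul_nonneg (hc i).le (by positivity)
  have := finiteDimensional_range_of_sum P _ z hPz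
  obtain ⟨m', l, w, hPsvd⟩ := exists_eigendecomposition P hPpos
  have hle : schattenSum p T ≤ schattenSum p P := by
    refine schattenSum_mono hp0 fun n => ?_
    rcases lt_or_ge n m with hn | hn
    swap
    · rw [hsvd.singularNumber_eq_zero hn]; exact zero_le
    refine (hsvd.singularNumber_le ⟨n, hn⟩).trans ?_
    refine IsSVD.le_singularNumber_of_inner hsvd.antitone hsvd.left P (fun f => ?_) ⟨n, hn⟩
    have hA : ((∑ n, s n * ‖inner ℂ (u n) f‖ ^ 2 : ℝ) : ℂ) =
        ∑ n, inner ℂ (v n) (T f) * inner ℂ f (u n) := by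
      rw [Complex.ofReal_sum]
      refine Finset.sum_congr rfl fun n _ => ?_
      rw [hsvd.apply_eq, inner_sum_smul_orthonormal hsvd.right, ← inner_conj_symm f (u n),
        mul_assoc, Complex.mul_conj']
      push_cast
      rfl
    have hB : ∑ n, inner ℂ (v n) (T f) * inner ℂ f (u n) =
        ∑ i, (c i : ℂ) * (inner ℂ (x i) f * inner ℂ f (y' i)) := by
      simp only [hT, inner_sum, inner_smul_right, Finset.sum_mul, y', Finset.mul_sum]
      rw [Finset.sum_comm]
      refine Finset.sum_congr rfl fun i _ => Finset.sum_congr rfl fun n _ => ?_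
      ring
    have hC := congrArg Complex.re (hA.trans hB)
    rw [Complex.ofReal_re] at hC
    rw [hC, hPform, RCLike.re_eq_complex_re, Complex.ofReal_re, Complex.re_sum]
    refine Finset.sum_le_sum fun i _ => ?_
    rw [Complex.re_ofReal_mul]
    refine mul_le_mul_of_nonneg_left ?_ (hc i).le
    have := re_mul_inner_le (inner ℂ (x i) f) (inner ℂ (y' i) f)
    rw [inner_conj_symm] at this
    refine this.trans_eq ?_
    rw [inner_smul_left, inner_add_left, map_div₀, map_one, Complex.conj_ofNat]
  refine hle.trans ?_
  rw [hPsvd.schattenSum_eq hp0]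
  simp only [ENNReal.ofReal_rpow_of_pos (hc _), ENNReal.ofReal_rpow_of_pos (hPsvd.pos _)]
  rw [← ENNReal.ofReal_sum_of_nonneg (fun n _ => Real.rpow_nonneg (hPsvd.pos n).le _),
    ← ENNReal.ofReal_sum_of_nonneg (fun i _ => Real.rpow_nonneg (hc i).le _)]
  exact ENNReal.ofReal_le_ofReal (sum_rpow_eigenvalues_le hp0 hp1 hPsvd c z hc hz hPz)

lemma schattenSum_add_le_of_finiteDimensional [CompleteSpace H] {p : ℝ} (hp0 : 0 < p) (hp1 : p ≤ 1)
    (S T : H →L[ℂ] H) [FiniteDimensional ℂ (LinearMap.range (S : H →ₗ[ℂ] H))]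
    [FiniteDimensional ℂ (LinearMap.range (T : H →ₗ[ℂ] H))] :
    schattenSum p (S + T) ≤ schattenSum p S + schattenSum p T := by
  obtain ⟨m, s, u, v, hS⟩ := exists_isSVD S
  obtain ⟨n, t, x, y, hT⟩ := exists_isSVD T
  refine (schattenSum_le_sum_rpow hp0 hp1 (S + T) (Sum.elim s t) (Sum.elim u x) (Sum.elim v y)
    ?_ ?_ ?_ ?_).trans_eq ?_
  · rintro (i | i)
    exacts [hS.pos i, hT.pos i]
  · rintro (i | i)
    exacts [(hS.left.1 i).le, (hT.left.1 i).le]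
  · rintro (i | i)
    exacts [(hS.right.1 i).le, (hT.right.1 i).le]
  · intro f
    rw [add_apply, hS.apply_eq, hT.apply_eq, Fintype.sum_sum_type]
    rfl
  · rw [hS.schattenSum_eq hp0, hT.schattenSum_eq hp0, Fintype.sum_sum_type]
    rfl

lemma exists_finiteDimensional_approx {p : ℝ} (hp0 : 0 < p) (T : H →L[ℂ] H)
    (hT : schattenSum p T ≠ ∞) {ε : ℝ} (hε : 0 < ε) :
    ∃ R : H →L[ℂ] H, FiniteDimensional ℂ (LinearMap.range (R : H →ₗ[ℂ] H)) ∧ ‖T - R‖ < ε := by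
  have h0 : Filter.Tendsto (fun n => singularNumber n T ^ p) Filter.atTop (nhds 0) :=
    ENNReal.tendsto_atTop_zero_of_tsum_ne_top hT
  have hpos : 0 < ENNReal.ofReal ε ^ p :=
    ENNReal.rpow_pos (ENNReal.ofReal_pos.2 hε) ENNReal.ofReal_ne_top
  obtain ⟨n, hn⟩ := (h0.eventually_lt_const hpos).exists
  rw [ENNReal.rpow_lt_rpow_iff hp0, singularNumber] at hn
  simp only [iInf_lt_iff] at hn
  obtain ⟨R, hR, hlt⟩ := hn
  refine ⟨R, ?_, ?_⟩
  · rw [LinearMap.rank] at hR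
    exact Module.rank_lt_aleph0_iff.1 (hR.trans_lt Cardinal.natCast_lt_aleph0)
  · rwa [← ofReal_norm, ENNReal.ofReal_lt_ofReal_iff hε] at hlt

/-- The projection fixes `R`, so the error is that of `T - R` minus its projection. Unlike `R`, the
compressed operator has singular numbers no larger than those of `T`. -/
lemma norm_sub_starProjection_comp_le {T R : H →L[ℂ] H} (V : Submodule ℂ H)
    [V.HasOrthogonalProjection] (hV : LinearMap.range (R : H →ₗ[ℂ] H) ≤ V) :
    ‖T - V.starProjection ∘L T‖ ≤ 2 * ‖T - R‖ := by
  have hR : V.starProjection ∘L R = R := by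
    ext x
    exact V.starProjection_eq_self_iff.2 (hV ⟨x, rfl⟩)
  have : T - V.starProjection ∘L T = (T - R) - V.starProjection ∘L (T - R) := by
    rw [ContinuousLinearMap.comp_sub, hR]; abel
  rw [this, two_mul]
  refine (norm_sub_le _ _).trans (add_le_add le_rfl ?_)
  refine (ContinuousLinearMap.opNorm_comp_le _ _).trans ?_
  exact mul_le_of_le_one_left (norm_nonneg _) V.starProjection_norm_le

lemma finiteDimensional_range_starProjection_comp (V : Submodule ℂ H) [FiniteDimensional ℂ V]
    (T : H →L[ℂ] H) :
    FiniteDimensional ℂ (LinearMap.range ((V.starProjection ∘L T : H →L[ℂ] H) : H →ₗ[ℂ] H)) := by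
  refine Submodule.finiteDimensional_of_le (S₂ := V) ?_
  rintro _ ⟨x, rfl⟩
  exact V.starProjection_apply_mem (T x)

/-- The `p`-triangle inequality for the Schatten quasi-norm, `0 < p ≤ 1`. -/
lemma schattenSum_add_le [CompleteSpace H] {p : ℝ} (hp0 : 0 < p) (hp1 : p ≤ 1)
    (S T : H →L[ℂ] H) :
    schattenSum p (S + T) ≤ schattenSum p S + schattenSum p T := by
  by_cases hS : schattenSum p S = ∞
  · simp [hS]
  by_cases hT : schattenSum p T = ∞
  · simp [hT]
  refine schattenSum_le_of_approx hp0 _ _ fun ε hε => ?_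
  -- Projecting doubles each of the two errors, hence `ε / 4`.
  obtain ⟨A, hA, hSA⟩ := exists_finiteDimensional_approx hp0 S hS (show 0 < ε / 4 by positivity)
  obtain ⟨B, hB, hTB⟩ := exists_finiteDimensional_approx hp0 T hT (show 0 < ε / 4 by positivity)
  let V : Submodule ℂ H := LinearMap.range (A : H →ₗ[ℂ] H) ⊔ LinearMap.range (B : H →ₗ[ℂ] H)
  have h1 := norm_sub_starProjection_comp_le (T := S) (R := A) V le_sup_left
  have h2 := norm_sub_starProjection_comp_le (T := T) (R := B) V le_sup_right
  have := finiteDimensional_range_starProjection_comp V S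
  have := finiteDimensional_range_starProjection_comp V T
  refine ⟨V.starProjection ∘L S + V.starProjection ∘L T, ?_, ?_⟩
  · rw [show S + T - (V.starProjection ∘L S + V.starProjection ∘L T) =
      (S - V.starProjection ∘L S) + (T - V.starProjection ∘L T) by abel]
    refine (norm_add_le _ _).trans ?_
    linarith
  · refine (schattenSum_add_le_of_finiteDimensional hp0 hp1 _ _).trans (add_le_add ?_ ?_)
    · exact schattenSum_mono hp0 fun n =>
        singularNumber_comp_left_le n _ _ V.starProjection_norm_le
    · exact schattenSum_mono hp0 fun n =>
        singularNumber_comp_left_le n _ _ V.starProjection_norm_le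

lemma schattenSum_finset_sum_le [CompleteSpace H] {ι : Type*} {p : ℝ} (hp0 : 0 < p) (hp1 : p ≤ 1)
    (s : Finset ι) (T : ι → H →L[ℂ] H) :
    schattenSum p (∑ i ∈ s, T i) ≤ ∑ i ∈ s, schattenSum p (T i) := by
  classical
  induction s using Finset.induction_on with
  | empty => simp [schattenSum_zero hp0]
  | insert a s ha ih =>
    rw [Finset.sum_insert ha, Finset.sum_insert ha]
    exact (schattenSum_add_le hp0 hp1 _ _).trans (by gcongr)

lemma schattenSum_le_tsum [CompleteSpace H] {ι : Type*} {p : ℝ} (hp0 : 0 < p) (hp1 : p ≤ 1)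
    {S : H →L[ℂ] H} {T : ι → H →L[ℂ] H} (h : HasSum T S) :
    schattenSum p S ≤ ∑' i, schattenSum p (T i) := by
  refine schattenSum_le_of_approx hp0 _ _ fun ε hε => ?_
  obtain ⟨s, hs⟩ := (Metric.tendsto_nhds.1 h ε hε).exists
  refine ⟨∑ i ∈ s, T i, ?_, ?_⟩
  · rw [dist_comm, dist_eq_norm] at hs
    exact hs.le
  · exact (schattenSum_finset_sum_le hp0 hp1 s T).trans (ENNReal.sum_le_tsum s)

end Triangle

/-! ### Rank one kernels, linearity and injectivity of `Op`. -/

section Kernels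

lemma memLp_conj_mul (u v : L2R) :
    MemLp (fun z : ℝ × ℝ => (starRingEnd ℂ) (u z.1) * v z.2) 2 (volume : Measure (ℝ × ℝ)) := by
  have hm : AEStronglyMeasurable (fun z : ℝ × ℝ => (starRingEnd ℂ) (u z.1) * v z.2)
      (volume : Measure (ℝ × ℝ)) :=
    (Complex.continuous_conj.comp_aestronglyMeasurable
      (Lp.aestronglyMeasurable u).comp_fst).mul (Lp.aestronglyMeasurable v).comp_snd
  rw [memLp_two_iff_integrable_sq_norm hm]
  have h := ((memLp_two_iff_integrable_sq_norm (Lp.aestronglyMeasurable u)).1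
    (Lp.memLp u)).mul_prod ((memLp_two_iff_integrable_sq_norm (Lp.aestronglyMeasurable v)).1
    (Lp.memLp v))
  refine h.congr (Filter.Eventually.of_forall fun z => ?_)
  simp [mul_pow]

/-- The kernel `(x, y) ↦ conj (u x) * v y` of the rank one operator `⟨u, ·⟩ v`. -/
noncomputable def rankOneKernel (u v : L2R) : L2R2 := (memLp_conj_mul u v).toLp _

lemma coeFn_rankOneKernel (u v : L2R) :
    ∀ᵐ z : ℝ × ℝ, rankOneKernel u v z = (starRingEnd ℂ) (u z.1) * v z.2 :=
  (memLp_conj_mul u v).coeFn_toLp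

/-- Fubini. Matrix coefficients of `Op φ` become `L_2` inner products with `φ`, which gives
linearity of `Op` and density of rank one kernels. -/
lemma inner_rankOneKernel (u v : L2R) (φ : L2R2) :
    inner ℂ (rankOneKernel u v) φ = inner ℂ v (Op φ u) := by
  have hint := L2.integrable_inner (𝕜 := ℂ) (rankOneKernel u v) φ
  have hae : (fun z : ℝ × ℝ => inner ℂ (rankOneKernel u v z) (φ z)) =ᵐ[volume]
      fun z => (starRingEnd ℂ) (v z.2) * (φ z * u z.1) := by
    filter_upwards [coeFn_rankOneKernel u v] with z hz
    rw [hz, RCLike.inner_apply, map_mul, Complex.conj_conj]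
    ring
  rw [L2.inner_def, integral_congr_ae hae, L2.inner_def]
  refine (integral_prod_symm _ (hint.congr hae)).trans ?_
  refine integral_congr_ae ?_
  filter_upwards [Op_apply_ae φ u] with y hy
  rw [hy, RCLike.inner_apply, integral_const_mul, mul_comm]

lemma inner_rankOneKernel_rankOneKernel (u v u' v' : L2R) :
    inner ℂ (rankOneKernel u v) (rankOneKernel u' v') = inner ℂ u' u * inner ℂ v v' := by
  have hae : (fun z : ℝ × ℝ => inner ℂ (rankOneKernel u v z) (rankOneKernel u' v' z)) =ᵐ[volume]
      fun z => inner ℂ (u' z.1) (u z.1) * inner ℂ (v z.2) (v' z.2) := by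
    filter_upwards [coeFn_rankOneKernel u v, coeFn_rankOneKernel u' v'] with z hz hz'
    simp only [hz, hz', RCLike.inner_apply, map_mul, Complex.conj_conj]
    ring
  rw [L2.inner_def, integral_congr_ae hae, Measure.volume_eq_prod,
    integral_prod_mul (fun x => inner ℂ (u' x) (u x)) (fun y => inner ℂ (v y) (v' y)),
    L2.inner_def, L2.inner_def]

lemma Op_add (φ ψ : L2R2) : Op (φ + ψ) = Op φ + Op ψ := by
  refine ContinuousLinearMap.ext fun u => ext_inner_left ℂ fun v => ?_
  rw [← inner_rankOneKernel, add_apply, inner_add_right, inner_add_right, inner_rankOneKernel,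
    inner_rankOneKernel]

lemma Op_smul (c : ℂ) (φ : L2R2) : Op (c • φ) = c • Op φ := by
  refine ContinuousLinearMap.ext fun u => ext_inner_left ℂ fun v => ?_
  rw [← inner_rankOneKernel, smul_apply, inner_smul_right, inner_smul_right, inner_rankOneKernel]

lemma norm_Op_le (φ : L2R2) : ‖Op φ‖ ≤ ‖φ‖ := by
  unfold Op
  exact LinearMap.mkContinuous_norm_le _ (norm_nonneg _) (fun f => by
    have h := ENNReal.toReal_mono
      (ENNReal.mul_ne_top enorm_ne_top enorm_ne_top) (kernel_eLpNorm_le φ f)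
    simpa [Lp.norm_toLp] using h)

/-- `Op` as a continuous linear map. -/
noncomputable def OpCLM : L2R2 →L[ℂ] (L2R →L[ℂ] L2R) :=
  LinearMap.mkContinuous { toFun := Op, map_add' := Op_add, map_smul' := Op_smul } 1 fun φ => by
    rw [one_mul]
    exact norm_Op_le φ

lemma OpCLM_apply (φ : L2R2) : OpCLM φ = Op φ := rfl

lemma Op_rankOneKernel (u v : L2R) :
    Op (rankOneKernel u v) = InnerProductSpace.rankOne ℂ v u := by
  refine ContinuousLinearMap.ext fun f => ext_inner_left ℂ fun g => ?_
  rw [← inner_rankOneKernel, inner_rankOneKernel_rankOneKernel, InnerProductSpace.rankOne_apply,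
    inner_smul_right]

lemma eq_zero_of_Op_eq_zero (φ : L2R2) (h : Op φ = 0) : φ = 0 := by
  have : Fact ((2 : ℝ≥0∞) ≠ ∞) := ⟨by simp⟩
  let f : ℕ → L2R := TopologicalSpace.denseSeq L2R
  -- Countability of the dense sequence gives one null set of `y` for all test functions; outside
  -- it, almost every slice of `φ` is orthogonal to a dense set.
  have h1 : ∀ᵐ y : ℝ, ∀ n, ∫ x, φ (x, y) * f n x = 0 := by
    rw [ae_all_iff]
    intro n
    filter_upwards [Op_apply_ae φ (f n), Lp.coeFn_zero ℂ 2 (volume : Measure ℝ)] with y hy h0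
    rw [← hy, h, zero_apply, h0, Pi.zero_apply]
  have hmeas : AEStronglyMeasurable (fun z : ℝ × ℝ => φ z.swap)
      ((volume : Measure ℝ).prod (volume : Measure ℝ)) :=
    (Lp.aestronglyMeasurable φ).prod_swap
  have hsq := kernel_sq_lintegral φ
  have hfin : ∀ᵐ y : ℝ, ∫⁻ x, ‖φ (x, y)‖ₑ ^ (2 : ℝ) < ∞ := by
    refine ae_lt_top' (hmeas.enorm.pow_const (2 : ℝ)).lintegral_prod_right' ?_
    refine ne_of_eq_of_ne hsq ?_
    exact ENNReal.rpow_ne_top_of_nonneg (by norm_num) enorm_ne_top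
  have hzero : ∀ᵐ y : ℝ, ∫⁻ x, ‖φ (x, y)‖ₑ ^ (2 : ℝ) = 0 := by
    filter_upwards [h1, hmeas.prodMk_left, hfin] with y hy hm hlt
    have hL : MemLp (fun x => (starRingEnd ℂ) (φ (x, y))) 2 (volume : Measure ℝ) := by
      refine ⟨Complex.continuous_conj.comp_aestronglyMeasurable hm, ?_⟩
      rw [eLpNorm_lt_top_iff_lintegral_rpow_enorm_lt_top (by simp) (by simp)]
      simpa using hlt
    have hg : hL.toLp _ = 0 := by
      refine (TopologicalSpace.denseRange_denseSeq L2R).eq_zero_of_inner_left ℂ ?_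
      intro n
      rw [L2.inner_def, ← hy n]
      refine integral_congr_ae ?_
      filter_upwards [hL.coeFn_toLp] with x hx
      rw [hx, RCLike.inner_apply, Complex.conj_conj, mul_comm]
    refine (lintegral_eq_zero_iff' (hm.enorm.pow_const (2 : ℝ))).2 ?_
    filter_upwards [hL.coeFn_toLp, Lp.coeFn_zero ℂ 2 (volume : Measure ℝ)] with x hx h0
    rw [hg, h0, Pi.zero_apply] at hx
    have : φ (x, y) = 0 := by simpa using hx.symm
    simp [this]
  rw [lintegral_congr_ae hzero, lintegral_zero] at hsq
  have := hsq.symm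
  rw [ENNReal.rpow_eq_zero_iff_of_pos (by norm_num)] at this
  simpa using this

lemma Op_injective : Injective Op := fun φ ψ h =>
  sub_eq_zero.1 <| eq_zero_of_Op_eq_zero _ <| by
    rw [← OpCLM_apply, map_sub, OpCLM_apply, OpCLM_apply, h, sub_self]

lemma norm_rankOneKernel (u v : L2R) : ‖rankOneKernel u v‖ = ‖u‖ * ‖v‖ := by
  have h := inner_rankOneKernel_rankOneKernel u v u v
  rw [inner_self_eq_norm_sq_to_K, inner_self_eq_norm_sq_to_K, inner_self_eq_norm_sq_to_K,
    ← mul_pow] at h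
  have h' : ‖rankOneKernel u v‖ ^ 2 = (‖u‖ * ‖v‖) ^ 2 := by exact_mod_cast h
  exact (sq_eq_sq₀ (norm_nonneg _) (by positivity)).1 h'

lemma rankOneKernel_add_left (u u' v : L2R) :
    rankOneKernel (u + u') v = rankOneKernel u v + rankOneKernel u' v := by
  refine Op_injective ?_
  rw [Op_add, Op_rankOneKernel, Op_rankOneKernel, Op_rankOneKernel, map_add]

/-- `u ↦ rankOneKernel u v` as an additive map. -/
noncomputable def rankOneKernelHom (v : L2R) : L2R →+ L2R2 :=
  AddMonoidHom.mk' (fun u => rankOneKernel u v) fun u u' => rankOneKernel_add_left u u' v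

lemma continuous_rankOneKernelHom (v : L2R) : Continuous (rankOneKernelHom v) :=
  AddMonoidHomClass.continuous_of_bound _ ‖v‖ fun u => by
    rw [mul_comm]
    exact (norm_rankOneKernel u v).le

end Kernels

/-! ### Approximation of kernels in `L_2` by finite-rank truncations. -/

section Truncation

/-- The kernel of `Op φ` composed with the orthogonal projection onto `V`. -/
noncomputable def truncate (V : Submodule ℂ L2R) [FiniteDimensional ℂ V] (φ : L2R2) : L2R2 :=
  ∑ i, rankOneKernel (stdOrthonormalBasis ℂ V i) (Op φ (stdOrthonormalBasis ℂ V i))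

lemma starProjection_eq_sum (V : Submodule ℂ L2R) [FiniteDimensional ℂ V] (x : L2R) :
    V.starProjection x = ∑ i, inner ℂ (stdOrthonormalBasis ℂ V i : L2R) x •
      (stdOrthonormalBasis ℂ V i : L2R) := by
  have := congrArg (Subtype.val)
    ((stdOrthonormalBasis ℂ V).sum_repr' (V.orthogonalProjectionOnto x))
  simp only [Submodule.coe_sum, Submodule.coe_smul] at this
  rw [Submodule.starProjection_apply, ← this]
  refine Finset.sum_congr rfl fun i _ => ?_
  congr 1
  exact V.inner_orthogonalProjectionOnto_eq_of_mem_left (stdOrthonormalBasis ℂ V i) x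

lemma Op_truncate (V : Submodule ℂ L2R) [FiniteDimensional ℂ V] (φ : L2R2) :
    Op (truncate V φ) = Op φ ∘L V.starProjection := by
  refine ContinuousLinearMap.ext fun x => ?_
  rw [← OpCLM_apply, truncate, map_sum, ContinuousLinearMap.comp_apply, starProjection_eq_sum,
    map_sum, sum_apply]
  refine Finset.sum_congr rfl fun i _ => ?_
  rw [OpCLM_apply, Op_rankOneKernel, InnerProductSpace.rankOne_apply, map_smul]

/-- Truncation is the orthogonal projection in `L_2(ℝ²)` onto the kernels whose operators factor
through the projection onto `V`, hence a best approximation. -/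
lemma norm_sub_truncate_le (V : Submodule ℂ L2R) [FiniteDimensional ℂ V] (φ w : L2R2)
    (hw : Op w ∘L V.starProjection = Op w) : ‖φ - truncate V φ‖ ≤ ‖φ - w‖ := by
  set ψ := truncate V φ with hψ
  have hVV : V.starProjection ∘L V.starProjection = V.starProjection := by
    ext1 x
    exact V.starProjection_eq_self_iff.2 (V.starProjection_apply_mem x)
  have hsub : Op (w - ψ) ∘L V.starProjection = Op (w - ψ) := by
    rw [← OpCLM_apply, map_sub, OpCLM_apply, OpCLM_apply, ContinuousLinearMap.sub_comp, hw, hψ,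
      Op_truncate, ContinuousLinearMap.comp_assoc, hVV]
  have heq : w - ψ = truncate V (w - ψ) := Op_injective (by rw [Op_truncate, hsub])
  have horth : inner ℂ (w - ψ) (φ - ψ) = 0 := by
    rw [heq]
    conv_lhs => enter [2]; rw [truncate]
    rw [sum_inner]
    refine Finset.sum_eq_zero fun i _ => ?_
    rw [inner_rankOneKernel, ← OpCLM_apply (φ - ψ), map_sub, OpCLM_apply, OpCLM_apply, hψ,
      Op_truncate, sub_apply, ContinuousLinearMap.comp_apply,
      V.starProjection_eq_self_iff.2 (stdOrthonormalBasis ℂ V i).2, sub_self, inner_zero_right]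
  refine le_of_sq_le_sq ?_ (norm_nonneg _)
  rw [show φ - w = (φ - ψ) - (w - ψ) by abel, norm_sub_sq (𝕜 := ℂ) (φ - ψ),
    inner_eq_zero_symm.1 horth, map_zero, mul_zero, sub_zero]
  exact le_add_of_nonneg_right (sq_nonneg _)

lemma exists_comp_starProjection_eq {w : L2R2}
    (hw : w ∈ Submodule.span ℂ (Set.range fun q : L2R × L2R => rankOneKernel q.1 q.2)) :
    ∃ (V : Submodule ℂ L2R) (_ : FiniteDimensional ℂ V), Op w ∘L V.starProjection = Op w := by
  have hmono : ∀ (V W : Submodule ℂ L2R) [FiniteDimensional ℂ V] [FiniteDimensional ℂ W],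
      V ≤ W → ∀ φ : L2R2, Op φ ∘L V.starProjection = Op φ → Op φ ∘L W.starProjection = Op φ := by
    intro V W _ _ hVW φ hφ
    have hc : V.starProjection ∘L W.starProjection = V.starProjection :=
      Submodule.starProjection_comp_starProjection_of_le hVW
    rw [← hφ, ContinuousLinearMap.comp_assoc, hc]
  induction hw using Submodule.span_induction with
  | mem x hx =>
    obtain ⟨⟨u, v⟩, rfl⟩ := hx
    refine ⟨Submodule.span ℂ {u}, inferInstance, ?_⟩
    refine ContinuousLinearMap.ext fun x => ?_
    simp only [Op_rankOneKernel, ContinuousLinearMap.comp_apply, InnerProductSpace.rankOne_apply]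
    rw [← Submodule.inner_starProjection_left_eq_right,
      Submodule.starProjection_eq_self_iff.2 (Submodule.mem_span_singleton_self u)]
  | zero =>
    refine ⟨⊥, inferInstance, ?_⟩
    rw [← OpCLM_apply, map_zero, ContinuousLinearMap.zero_comp]
  | add x y _ _ hx hy =>
    obtain ⟨V, hV, hVx⟩ := hx
    obtain ⟨W, hW, hWy⟩ := hy
    refine ⟨V ⊔ W, inferInstance, ?_⟩
    rw [Op_add, ContinuousLinearMap.add_comp, hmono V (V ⊔ W) le_sup_left x hVx,
      hmono W (V ⊔ W) le_sup_right y hWy]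
  | smul c x _ hx =>
    obtain ⟨V, hV, hVx⟩ := hx
    refine ⟨V, hV, ?_⟩
    rw [Op_smul, ContinuousLinearMap.smul_comp, hVx]

lemma dense_span_rankOneKernel :
    (Submodule.span ℂ
      (Set.range fun q : L2R × L2R => rankOneKernel q.1 q.2)).topologicalClosure = ⊤ := by
  rw [Submodule.topologicalClosure_eq_top_iff, Submodule.eq_bot_iff]
  intro φ hφ
  refine eq_zero_of_Op_eq_zero φ ?_
  refine ContinuousLinearMap.ext fun u => ext_inner_left ℂ fun v => ?_
  rw [← inner_rankOneKernel, zero_apply, inner_zero_right]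
  exact Submodule.inner_right_of_mem_orthogonal (Submodule.subset_span (Set.mem_range_self (u, v))) hφ

/-- The approximation is in the `L_2` norm because multiplication by a bounded `k` is continuous
there; closeness of the operators alone would not suffice. -/
lemma exists_truncate_close (φ : L2R2) {ε : ℝ} (hε : 0 < ε) :
    ∃ (V : Submodule ℂ L2R) (_ : FiniteDimensional ℂ V), ‖φ - truncate V φ‖ < ε := by
  have hmem : φ ∈ closure ((Submodule.span ℂ
      (Set.range fun q : L2R × L2R => rankOneKernel q.1 q.2) : Submodule ℂ L2R2) : Set L2R2) := by
    rw [← Submodule.topologicalClosure_coe, dense_span_rankOneKernel]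
    trivial
  obtain ⟨w, hw, hd⟩ := Metric.mem_closure_iff.1 hmem ε hε
  obtain ⟨V, hV, hVw⟩ := exists_comp_starProjection_eq hw
  refine ⟨V, hV, (norm_sub_truncate_le V φ w hVw).trans_lt ?_⟩
  rwa [← dist_eq_norm]

/-- A finite-rank integral operator has a finite Schmidt expansion of its kernel. -/
lemma eq_sum_rankOneKernel {m : ℕ} {ψ : L2R2} {s : Fin m → ℝ} {u v : Fin m → L2R}
    (h : IsSVD (Op ψ) s u v) : ψ = ∑ i, (s i : ℂ) • rankOneKernel (u i) (v i) := by
  refine Op_injective (ContinuousLinearMap.ext fun f => ?_)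
  rw [h.apply_eq, ← OpCLM_apply, map_sum, sum_apply]
  refine Finset.sum_congr rfl fun i _ => ?_
  rw [map_smul, OpCLM_apply, Op_rankOneKernel, smul_apply, InnerProductSpace.rankOne_apply,
    smul_smul]

end Truncation

/-! ### Orthogonal splitting of `L_2(ℝ)` along a measurable partition. -/

section RestrictL2

/-- Multiplication of `u ∈ L_2(ℝ)` by the indicator function of `I`. -/
noncomputable def restrictL2 (I : Set ℝ) (hI : MeasurableSet I) (u : L2R) : L2R :=
  ((Lp.memLp u).indicator hI).toLp (I.indicator u)

lemma coeFn_restrictL2 (I : Set ℝ) (hI : MeasurableSet I) (u : L2R) :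
    ∀ᵐ x : ℝ, restrictL2 I hI u x = I.indicator u x :=
  ((Lp.memLp u).indicator hI).coeFn_toLp

lemma restrictL2_univ (u : L2R) : restrictL2 univ MeasurableSet.univ u = u := by
  refine Lp.ext ?_
  filter_upwards [coeFn_restrictL2 univ MeasurableSet.univ u] with x hx
  rw [hx, indicator_univ]

lemma inner_restrictL2_restrictL2 {I J : Set ℝ} (hI : MeasurableSet I) (hJ : MeasurableSet J)
    (u : L2R) :
    inner ℂ (restrictL2 I hI u) (restrictL2 J hJ u) = ((∫ x in I ∩ J, ‖u x‖ ^ 2 : ℝ) : ℂ) := by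
  rw [L2.inner_def, ← integral_indicator (hI.inter hJ), ← integral_complex_ofReal]
  refine integral_congr_ae ?_
  filter_upwards [coeFn_restrictL2 I hI u, coeFn_restrictL2 J hJ u] with x hx hy
  rw [hx, hy]
  by_cases h1 : x ∈ I <;> by_cases h2 : x ∈ J <;> simp [h1, h2]

lemma norm_restrictL2_sq {I : Set ℝ} (hI : MeasurableSet I) (u : L2R) :
    ‖restrictL2 I hI u‖ ^ 2 = ∫ x in I, ‖u x‖ ^ 2 := by
  have h := inner_restrictL2_restrictL2 hI hI u
  rw [← inner_self_eq_norm_sq (𝕜 := ℂ), h, inter_self, RCLike.re_eq_complex_re, Complex.ofReal_re]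

/-- By Pythagoras the squared error of a partial sum is `‖b‖ ^ 2` minus the partial sum of the `‖a
i‖ ^ 2`. -/
lemma hasSum_of_orthogonal {H : Type*} [NormedAddCommGroup H] [InnerProductSpace ℂ H] {ι : Type*}
    {a : ι → H} {b : H} (horth : ∀ i j, i ≠ j → inner ℂ (a i) (a j) = 0)
    (hab : ∀ i, inner ℂ b (a i) = ((‖a i‖ ^ 2 : ℝ) : ℂ))
    (hsum : HasSum (fun i => ‖a i‖ ^ 2) (‖b‖ ^ 2)) : HasSum a b := by
  classical
  have key : ∀ s : Finset ι, ‖b - ∑ i ∈ s, a i‖ ^ 2 = ‖b‖ ^ 2 - ∑ i ∈ s, ‖a i‖ ^ 2 := by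
    intro s
    have h1 : inner ℂ b (∑ i ∈ s, a i) = ((∑ i ∈ s, ‖a i‖ ^ 2 : ℝ) : ℂ) := by
      rw [inner_sum, Complex.ofReal_sum]
      exact Finset.sum_congr rfl fun i _ => hab i
    have h2 : ‖∑ i ∈ s, a i‖ ^ 2 = ∑ i ∈ s, ‖a i‖ ^ 2 := by
      have h : inner ℂ (∑ i ∈ s, a i) (∑ i ∈ s, a i) = ((∑ i ∈ s, ‖a i‖ ^ 2 : ℝ) : ℂ) := by
        rw [sum_inner, Complex.ofReal_sum]
        refine Finset.sum_congr rfl fun i hi => ?_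
        rw [inner_sum, Finset.sum_eq_single i (fun j _ hj => horth i j hj.symm)
          (fun h => absurd hi h), inner_self_eq_norm_sq_to_K]
        push_cast
        rfl
      rw [← inner_self_eq_norm_sq (𝕜 := ℂ), h, RCLike.re_eq_complex_re, Complex.ofReal_re]
    rw [norm_sub_sq (𝕜 := ℂ), h1, h2, RCLike.re_eq_complex_re, Complex.ofReal_re]
    ring
  have hlim : Filter.Tendsto (fun s : Finset ι => ‖b - ∑ i ∈ s, a i‖ ^ 2) Filter.atTop
      (nhds 0) := by
    simp only [key]
    have := hsum.const_sub (‖b‖ ^ 2)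
    rwa [sub_self] at this
  have hlim' := (Real.continuous_sqrt.tendsto 0).comp hlim
  rw [Real.sqrt_zero] at hlim'
  rw [HasSum, SummationFilter.unconditional_filter, tendsto_iff_norm_sub_tendsto_zero]
  refine hlim'.congr fun s => ?_
  rw [Function.comp_apply, Real.sqrt_sq (norm_nonneg _), norm_sub_rev]

variable {I : ℤ → Set ℝ} (hI : ∀ j, MeasurableSet (I j))

lemma hasSum_norm_restrictL2_sq (hdisj : Pairwise (Disjoint on I)) (hcover : ⋃ j, I j = univ)
    (u : L2R) : HasSum (fun j => ‖restrictL2 (I j) (hI j) u‖ ^ 2) (‖u‖ ^ 2) := by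
  have hint : IntegrableOn (fun x => ‖u x‖ ^ 2) (⋃ j, I j) :=
    ((memLp_two_iff_integrable_sq_norm (Lp.aestronglyMeasurable u)).1 (Lp.memLp u)).integrableOn
  have h := hasSum_integral_iUnion hI hdisj hint
  simp only [← norm_restrictL2_sq (hI _), hcover] at h
  rwa [← norm_restrictL2_sq MeasurableSet.univ, restrictL2_univ] at h

lemma hasSum_restrictL2 (hdisj : Pairwise (Disjoint on I)) (hcover : ⋃ j, I j = univ) (u : L2R) :
    HasSum (fun j => restrictL2 (I j) (hI j) u) u := by
  refine hasSum_of_orthogonal (fun i j hij => ?_) (fun j => ?_)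
    (hasSum_norm_restrictL2_sq hI hdisj hcover u)
  · rw [inner_restrictL2_restrictL2, (hdisj hij).inter_eq]
    simp
  · conv_lhs => enter [2]; rw [← restrictL2_univ u]
    rw [inner_restrictL2_restrictL2, univ_inter, norm_restrictL2_sq]

lemma tsum_enorm_restrictL2_sq (hdisj : Pairwise (Disjoint on I)) (hcover : ⋃ j, I j = univ)
    (u : L2R) : ∑' j, ‖restrictL2 (I j) (hI j) u‖ₑ ^ (2 : ℝ) = ‖u‖ₑ ^ (2 : ℝ) := by
  have h := hasSum_norm_restrictL2_sq hI hdisj hcover u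
  have h2 : ∀ v : L2R, ‖v‖ₑ ^ (2 : ℝ) = ENNReal.ofReal (‖v‖ ^ 2) := fun v => by
    rw [← ofReal_norm, ENNReal.ofReal_pow (norm_nonneg _)]
    exact_mod_cast rfl
  simp only [h2]
  rw [← ENNReal.ofReal_tsum_of_nonneg (fun _ => by positivity) h.summable, h.tsum_eq]

end RestrictL2

/-! ### Schur multipliers: the estimate on rank one kernels and its extension. -/

section SchurMultipliers

/-- `φ ↦ Op (k φ)` as a continuous linear map. -/
noncomputable def schurCLM (k : LinftyR2) : L2R2 →L[ℂ] (L2R →L[ℂ] L2R) :=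
  OpCLM ∘L (ContinuousLinearMap.mul ℂ ℂ).holderL (volume : Measure (ℝ × ℝ)) ∞ 2 2 k

lemma schurCLM_apply (k : LinftyR2) (φ : L2R2) : schurCLM k φ = Op (mulSymbol k φ) := rfl

lemma coeFn_mulSymbol (k : LinftyR2) (φ : L2R2) :
    ∀ᵐ z : ℝ × ℝ, mulSymbol k φ z = k z * φ z :=
  ((Lp.memLp φ).mul' (Lp.memLp k)).coeFn_toLp

/-- The kernel is supported on `I × ℝ`, so cutting `k` off in the first variable changes nothing
there. -/
lemma mulSymbol_restrictFst (I : Set ℝ) (hI : MeasurableSet I) (k : LinftyR2) (u v : L2R) :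
    mulSymbol (restrictFst I hI k) (rankOneKernel (restrictL2 I hI u) v) =
      mulSymbol k (rankOneKernel (restrictL2 I hI u) v) := by
  refine Lp.ext ?_
  have hk : ∀ᵐ z : ℝ × ℝ, restrictFst I hI k z = (Prod.fst ⁻¹' I).indicator k z :=
    ((Lp.memLp k).indicator (measurable_fst hI)).coeFn_toLp
  have hu : ∀ᵐ z : ℝ × ℝ, restrictL2 I hI u z.1 = I.indicator u z.1 :=
    Measure.quasiMeasurePreserving_fst.ae (coeFn_restrictL2 I hI u)
  filter_upwards [coeFn_mulSymbol (restrictFst I hI k) (rankOneKernel (restrictL2 I hI u) v),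
    coeFn_mulSymbol k (rankOneKernel (restrictL2 I hI u) v), hk, hu,
    coeFn_rankOneKernel (restrictL2 I hI u) v] with z h1 h2 h3 h4 h5
  rw [h1, h2, h3, h5, h4]
  by_cases h : z.1 ∈ I
  · rw [indicator_of_mem (show z ∈ Prod.fst ⁻¹' I from h)]
  · rw [indicator_of_notMem h]
    simp

lemma schattenSum_rankOne_le {p : ℝ} (hp0 : 0 < p) (hp1 : p ≤ 1) {u v : L2R} (hu : ‖u‖ ≤ 1)
    (hv : ‖v‖ ≤ 1) : schattenSum p (InnerProductSpace.rankOne ℂ v u) ≤ 1 := by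
  refine (schattenSum_le_sum_rpow hp0 hp1 _ (fun _ : Unit => (1 : ℝ)) (fun _ => u) (fun _ => v)
    (fun _ => one_pos) (fun _ => hu) (fun _ => hv) fun f => ?_).trans_eq ?_
  · simp [InnerProductSpace.rankOne_apply]
  · simp

lemma schattenSum_mulSymbol_rankOneKernel_le {p : ℝ} (hp0 : 0 < p) (hp1 : p ≤ 1) (k : LinftyR2)
    (u v : L2R) :
    schattenSum p (Op (mulSymbol k (rankOneKernel u v))) ≤
      schurNorm p k ^ p * (‖u‖ₑ * ‖v‖ₑ) ^ p := by
  -- Normalising is impossible here, and the bound holds even if the multiplier quasi-norm is `∞`,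
  -- since both sides are `0`.
  rcases eq_or_ne (‖u‖ * ‖v‖) 0 with h0 | h0
  · have : rankOneKernel u v = 0 := by rw [← norm_eq_zero, norm_rankOneKernel, h0]
    rw [this, ← schurCLM_apply, map_zero, schattenSum_zero hp0]
    exact zero_le
  have hu0 : ‖u‖ ≠ 0 := left_ne_zero_of_mul h0
  have hv0 : ‖v‖ ≠ 0 := right_ne_zero_of_mul h0
  let u' : L2R := ((‖u‖ : ℂ)⁻¹) • u
  let v' : L2R := ((‖v‖ : ℂ)⁻¹) • v
  have hu' : ‖u'‖ ≤ 1 := by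
    rw [norm_smul, norm_inv, Complex.norm_real, norm_norm, inv_mul_cancel₀ hu0]
  have hv' : ‖v'‖ ≤ 1 := by
    rw [norm_smul, norm_inv, Complex.norm_real, norm_norm, inv_mul_cancel₀ hv0]
  have hu0' : (‖u‖ : ℂ) ≠ 0 := by exact_mod_cast hu0
  have hv0' : (‖v‖ : ℂ) ≠ 0 := by exact_mod_cast hv0
  have heq : rankOneKernel u v = ((‖u‖ * ‖v‖ : ℝ) : ℂ) • rankOneKernel u' v' := by
    refine Op_injective (ContinuousLinearMap.ext fun f => ?_)
    rw [Op_smul, Op_rankOneKernel, Op_rankOneKernel, smul_apply, InnerProductSpace.rankOne_apply,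
      InnerProductSpace.rankOne_apply, inner_smul_left, smul_smul, smul_smul, map_inv₀,
      Complex.conj_ofReal]
    congr 1
    push_cast
    field_simp
  have hφ : schattenNorm p (Op (rankOneKernel u' v')) ≤ 1 := by
    rw [schattenNorm_eq, Op_rankOneKernel]
    exact ENNReal.rpow_le_one (schattenSum_rankOne_le hp0 hp1 hu' hv') (by positivity)
  have hle : schattenNorm p (Op (mulSymbol k (rankOneKernel u' v'))) ≤ schurNorm p k :=
    le_iSup₂ (f := fun (φ : L2R2) (_ : schattenNorm p (Op φ) ≤ 1) =>
      schattenNorm p (Op (mulSymbol k φ))) (rankOneKernel u' v') hφ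
  rw [heq, ← schurCLM_apply, map_smul, mul_comm (schurNorm p k ^ p)]
  refine (schattenSum_smul_le hp0 _ _).trans (mul_le_mul' (le_of_eq ?_) ?_)
  · congr 1
    rw [← ofReal_norm, Complex.norm_real, Real.norm_of_nonneg (by positivity),
      ENNReal.ofReal_mul (norm_nonneg _), ofReal_norm, ofReal_norm]
  · rw [schurCLM_apply, ← schattenNorm_rpow hp0]
    exact ENNReal.rpow_le_rpow hle hp0.le

lemma pFlat_pos {p : ℝ} (hp0 : 0 < p) (hp1 : p ≤ 1) : 0 < pFlat p :=
  div_pos (by linarith) (by linarith)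

/-- Hölder's inequality with exponents `p^♭ / p` and `2 / p`. -/
lemma tsum_rpow_mul_rpow_le {p : ℝ} (hp0 : 0 < p) (hp1 : p ≤ 1) (M a : ℤ → ℝ≥0∞) :
    ∑' j, M j ^ p * a j ^ p ≤ ellNorm (pFlat p) M ^ p * (∑' j, a j ^ (2 : ℝ)) ^ (p / 2) := by
  have hr := pFlat_pos hp0 hp1
  have h2p : (2 - p) ≠ 0 := by linarith
  -- The reciprocals are `(2 - p) / 2` and `p / 2`; this identity dictates `p^♭`.
  have hconj : (pFlat p / p).HolderConjugate (2 / p) := by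
    rw [Real.holderConjugate_iff]
    have e : pFlat p / p = 2 / (2 - p) := by
      rw [pFlat]; field_simp
    rw [e]
    constructor
    · rw [lt_div_iff₀ (by linarith)]; linarith
    · field_simp; ring
  rw [ENNReal.tsum_eq_iSup_sum]
  refine iSup_le fun s => ?_
  refine (ENNReal.inner_le_Lp_mul_Lq s (fun j => M j ^ p) (fun j => a j ^ p) hconj).trans ?_
  simp only [← ENNReal.rpow_mul, mul_div_cancel₀ _ hp0.ne']
  refine mul_le_mul' ?_ ?_
  · rw [ellNorm, ← ENNReal.rpow_mul, one_div_div, one_div_mul_eq_div]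
    exact ENNReal.rpow_le_rpow (ENNReal.sum_le_tsum s) (by positivity)
  · rw [one_div_div]
    exact ENNReal.rpow_le_rpow (ENNReal.sum_le_tsum s) (by positivity)

variable {I : ℤ → Set ℝ} (hI : ∀ j, MeasurableSet (I j))

lemma schattenSum_rankOneKernel_le_ellNorm (hdisj : Pairwise (Disjoint on I))
    (hcover : ⋃ j, I j = univ) {p : ℝ} (hp0 : 0 < p) (hp1 : p ≤ 1) (k : LinftyR2) (u v : L2R) :
    schattenSum p (schurCLM k (rankOneKernel u v)) ≤
      ellNorm (pFlat p) (fun j => schurNorm p (restrictFst (I j) (hI j) k)) ^ p *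
        (‖u‖ₑ * ‖v‖ₑ) ^ p := by
  -- The orthogonal series for `u` is carried by continuous additive maps to a series converging in
  -- operator norm, as `schattenSum_le_tsum` requires.
  have hsum : HasSum (fun j => schurCLM k (rankOneKernel (restrictL2 (I j) (hI j) u) v))
      (schurCLM k (rankOneKernel u v)) :=
    ((hasSum_restrictL2 hI hdisj hcover u).map (rankOneKernelHom v)
      (continuous_rankOneKernelHom v)).mapL (schurCLM k)
  refine (schattenSum_le_tsum hp0 hp1 hsum).trans ?_
  calc ∑' j, schattenSum p (schurCLM k (rankOneKernel (restrictL2 (I j) (hI j) u) v))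
      ≤ ∑' j, (schurNorm p (restrictFst (I j) (hI j) k) ^ p *
          ‖restrictL2 (I j) (hI j) u‖ₑ ^ p) * ‖v‖ₑ ^ p := by
        refine ENNReal.tsum_le_tsum fun j => ?_
        rw [schurCLM_apply, ← mulSymbol_restrictFst, mul_assoc,
          ← ENNReal.mul_rpow_of_nonneg _ _ hp0.le]
        exact schattenSum_mulSymbol_rankOneKernel_le hp0 hp1 _ _ _
    _ ≤ (ellNorm (pFlat p) (fun j => schurNorm p (restrictFst (I j) (hI j) k)) ^ p *
          ‖u‖ₑ ^ p) * ‖v‖ₑ ^ p := by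
        rw [ENNReal.tsum_mul_right]
        refine mul_le_mul' ((tsum_rpow_mul_rpow_le hp0 hp1 _ _).trans_eq ?_) le_rfl
        rw [tsum_enorm_restrictL2_sq hI hdisj hcover, ← ENNReal.rpow_mul,
          mul_div_cancel₀ _ two_ne_zero]
    _ = _ := by rw [mul_assoc, ← ENNReal.mul_rpow_of_nonneg _ _ hp0.le]

/-- A bound for a Schur multiplier on rank one kernels extends to all kernels. -/
lemma schattenSum_schurCLM_le {p : ℝ} (hp0 : 0 < p) (hp1 : p ≤ 1) (k : LinftyR2) (C : ℝ≥0∞)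
    (h : ∀ u v : L2R, schattenSum p (schurCLM k (rankOneKernel u v)) ≤ C * (‖u‖ₑ * ‖v‖ₑ) ^ p)
    (φ : L2R2) : schattenSum p (schurCLM k φ) ≤ C * schattenSum p (Op φ) := by
  refine schattenSum_le_of_approx hp0 _ _ fun ε hε => ?_
  obtain ⟨V, hV, hclose⟩ := exists_truncate_close φ
    -- Adding `1` keeps the denominator positive when the multiplier map is zero.
    (show 0 < ε / (‖schurCLM k‖ + 1) by positivity)
  refine ⟨schurCLM k (truncate V φ), ?_, ?_⟩
  · rw [← map_sub]
    refine ((schurCLM k).le_opNorm _).trans ?_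
    rw [lt_div_iff₀ (by positivity)] at hclose
    nlinarith [norm_nonneg (φ - truncate V φ), norm_nonneg (schurCLM k)]
  · have hfd : FiniteDimensional ℂ (LinearMap.range (Op (truncate V φ) : L2R →ₗ[ℂ] L2R)) := by
      refine finiteDimensional_range_of_sum _ (fun i x => inner ℂ
        (stdOrthonormalBasis ℂ V i : L2R) x) (fun i => Op φ (stdOrthonormalBasis ℂ V i))
        fun x => ?_
      rw [Op_truncate, ContinuousLinearMap.comp_apply, starProjection_eq_sum, map_sum]
      exact Finset.sum_congr rfl fun i _ => map_smul _ _ _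
    obtain ⟨m, s, u, v, hsvd⟩ := exists_isSVD (Op (truncate V φ))
    calc schattenSum p (schurCLM k (truncate V φ))
        = schattenSum p (∑ i, (s i : ℂ) • schurCLM k (rankOneKernel (u i) (v i))) := by
          rw [eq_sum_rankOneKernel hsvd, map_sum]
          simp only [map_smul]
      _ ≤ ∑ i, C * ENNReal.ofReal (s i) ^ p := by
          refine (schattenSum_finset_sum_le hp0 hp1 _ _).trans
            (Finset.sum_le_sum fun i _ => ?_)
          refine (schattenSum_smul_le hp0 _ _).trans ?_
          have h1 := h (u i) (v i)
          rw [← ofReal_norm (u i), ← ofReal_norm (v i), hsvd.left.1 i, hsvd.right.1 i] at h1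
          rw [← ofReal_norm, Complex.norm_real, Real.norm_of_nonneg (hsvd.pos i).le, mul_comm]
          refine mul_le_mul' ?_ le_rfl
          simpa using h1
      _ = C * schattenSum p (Op (truncate V φ)) := by
          rw [← Finset.mul_sum, hsvd.schattenSum_eq hp0]
      _ ≤ C * schattenSum p (Op φ) := by
          -- Truncation composes `Op φ` with a projection, so no singular number grows and the
          -- constant `C` survives the limit.
          refine mul_le_mul' le_rfl (schattenSum_mono hp0 fun n => ?_)
          rw [Op_truncate]
          exact singularNumber_comp_right_le n _ _ V.starProjection_norm_le

end SchurMultipliers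

theorem mainTheorem5 (k : LinftyR2) (p : ℝ) (hp0 : 0 < p) (hp1 : p ≤ 1)
    (t : ℤ → ℝ)
    (hdisj : Pairwise (Disjoint on fun j : ℤ => Ico (t j) (t (j + 1))))
    (hcover : ⋃ j : ℤ, Ico (t j) (t (j + 1)) = univ) :
    schurNorm p k ≤
      ellNorm (pFlat p)
        (fun j : ℤ => schurNorm p (restrictFst (Ico (t j) (t (j + 1))) measurableSet_Ico k)) := by
  refine iSup₂_le fun φ hφ => ?_
  rw [← ENNReal.rpow_le_rpow_iff hp0, schattenNorm_rpow hp0]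
  refine (schattenSum_schurCLM_le hp0 hp1 k _ (fun u v =>
    schattenSum_rankOneKernel_le_ellNorm (fun _ => measurableSet_Ico) hdisj hcover hp0 hp1 k u v)
    φ).trans (mul_le_of_le_one_right' ?_)
  rw [← schattenNorm_rpow hp0]
  exact ENNReal.rpow_le_one hφ hp0.le
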